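/- Notation. For a finite simple graph $G$ on vertex set $[n]=\{1,\dots,n\}$ with $m=e(G)\ge 1$ edges and a partition $\mathcal A$ of $[n]$, let $$q_{\mathcal A}(G)=\frac1{2m}\sum_{A\in\mathcal A}\sum_{u,v\in A}\Big(\mathbf 1_{uv\in E(G)}-\frac{\deg(u)\deg(v)}{2m}\Big),$$ and let $q_{\mathcal A}(G)=0$ if $e(G)=0$. Let $q^*(G)=\max_{\mathcal A}q_{\mathcal A}(G)$, the maximum being over all partitions of $[n]$, and let $\delta_{\mathcal A}(G)=q^*(G)-q_{\mathcal A}(G)$. For $c>0$, the $cn$-edge-limited search on $G$ starts with $F=\emptyset$ and with $\tilde E$ the set of all edges of the complete graph $K_n$; while $\tilde E\ne\emptyset$ and $|F|<cn$, it samples $e\in\tilde E$ uniformly at random, deletes $e$ from $\tilde E$, and adds $e$ to $F$ if $e\in E(G)$. It returns the random graph $G^{cn}=([n],F)$. Statement. For every $\varepsilon>0$ there are a constant $c=c(\varepsilon)>0$, an algorithm (a program for a unit-cost random access machine with addition and subtraction, depending only on $\varepsilon$) and a constant $K=K(\varepsilon)$ such that the following holds. Given any graph $H$ on a vertex set $[n]$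 (as a list of edges) and any partition $\mathcal A$ of $[n]$ (as a list of labels of the vertices), the algorithm outputs a partition $\mathcal A'$ of $[n]$ after at most $K\,(n+e(H)+1)$ operations. For every $n\ge 0$ and every graph $G$ on $[n]$, with probability at least $1-\varepsilon$ the output graph $G^{cn}$ of the $cn$-edge-limited search on $G$ satisfies both (a) $|q^*(G^{cn})-q^*(G)|<\varepsilon$; and (b) for every partition $\mathcal A$ of $[n]$, the algorithm, given only $G^{cn}$ and $\mathcal A$, finds (in this linear number of operations) a partition $\mathcal A'$ with $\delta_{\mathcal A'}(G)\le\delta_{\mathcal A}(G^{cn})+\varepsilon$. -/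

import Mathlib

namespace GraphModularity

/-! ### Modularity -/

section Modularity

variable {n : ℕ}

/-- The number of edges of `G`. -/
noncomputable def edgeCount (G : SimpleGraph (Fin n)) : ℕ := G.edgeSet.ncard

open scoped Classical in
/-- The modularity score of the vertex partition `A` on the graph `G` with `m ≥ 1` edges,
`(1 / 2m) * ∑_{P ∈ A} ∑_{u, v ∈ P} (1_{uv ∈ E} - deg u * deg v / 2m)`;
it is `0` by convention if `G` has no edges. -/
noncomputable def modScore (G : SimpleGraph (Fin n))
    (A : Finpartition (Finset.univ : Finset (Fin n))) : ℝ :=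
  if edgeCount G = 0 then 0 else
    1 / (2 * (edgeCount G : ℝ)) * ∑ P ∈ A.parts, ∑ u ∈ P, ∑ v ∈ P,
      ((if G.Adj u v then (1 : ℝ) else 0)
        - (G.degree u : ℝ) * (G.degree v : ℝ) / (2 * (edgeCount G : ℝ)))

/-- The modularity `q^*(G)`: the maximum of the scores of the (finitely many) vertex partitions. -/
noncomputable def modularity (G : SimpleGraph (Fin n)) : ℝ :=
  ⨆ A : Finpartition (Finset.univ : Finset (Fin n)), modScore G A

/-- The modularity deficit `q^*(G) - q_A(G)` of the vertex partition `A`. -/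
noncomputable def deficit (G : SimpleGraph (Fin n))
    (A : Finpartition (Finset.univ : Finset (Fin n))) : ℝ :=
  modularity G - modScore G A

end Modularity

/-! ### Edge-limited search -/

section Search

variable {n : ℕ}

open scoped Classical in
/-- The loop of the search for edges of `G` with limit `b`, from a state with the set `Q` of
pairs that have not been queried yet and the set `F` of edges found so far: while `Q` is nonempty
and `|F| < b`, sample `e ∈ Q` uniformly at random, delete it from `Q`, and if `e` is an edge of `G`
add it to `F`. The result is the law of the set `F` that is returned. -/
noncomputable def searchLoop (G : SimpleGraph (Fin n)) (b : ℝ) (Q F : Finset (Sym2 (Fin n))) :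
    PMF (Finset (Sym2 (Fin n))) :=
  if h : Q.Nonempty ∧ (F.card : ℝ) < b then
    haveI : Nonempty {e // e ∈ Q} := h.1.to_subtype
    (PMF.uniformOfFintype {e // e ∈ Q}).bind fun e =>
      searchLoop G b (Q.erase e.1) (if e.1 ∈ G.edgeSet then insert e.1 F else F)
  else PMF.pure F
termination_by Q.card
decreasing_by exact Finset.card_erase_lt_of_mem e.2

open scoped Classical in
/-- The law of the random graph returned by `b`-edge-limited search on `G`: initially `F` is empty
and all edges of the complete graph are still to be queried. -/
noncomputable def edgeLimitedSearch (G : SimpleGraph (Fin n)) (b : ℝ) :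
    PMF (SimpleGraph (Fin n)) :=
  (searchLoop G b (⊤ : SimpleGraph (Fin n)).edgeFinset ∅).map
    fun F => SimpleGraph.fromEdgeSet (F : Set (Sym2 (Fin n)))

end Search

/-! ### Random access machines with unit cost -/

/-- A configuration: registers, of which a program names only finitely many, and a memory that
is accessed by indirect addressing. All of them hold natural numbers. -/
structure Store where
  reg : ℕ → ℕ
  mem : ℕ → ℕ

/-- The elementary operations. There is no multiplication. -/
inductive Op where
  /-- `r_i := k` -/
  | const (i k : ℕ)
  /-- `r_i := r_j + r_k` -/
  | add (i j k : ℕ)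
  /-- `r_i := max (r_j - r_k) 0` -/
  | sub (i j k : ℕ)
  /-- `r_i := mem[r_j]` -/
  | load (i j : ℕ)
  /-- `mem[r_i] := r_j` -/
  | store (i j : ℕ)

/-- The effect of an elementary operation. -/
def Op.run : Op → Store → Store
  | .const i k, s => { s with reg := Function.update s.reg i k }
  | .add i j k, s => { s with reg := Function.update s.reg i (s.reg j + s.reg k) }
  | .sub i j k, s => { s with reg := Function.update s.reg i (s.reg j - s.reg k) }
  | .load i j, s => { s with reg := Function.update s.reg i (s.mem (s.reg j)) }
  | .store i j, s => { s with mem := Function.update s.mem (s.reg i) (s.reg j) }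

/-- Programs, with structured control flow. -/
inductive Program where
  | op (o : Op)
  | seq (p q : Program)
  /-- `if r_i > 0 then p else q` -/
  | ifPos (i : ℕ) (p q : Program)
  /-- `while r_i > 0 do p` -/
  | whilePos (i : ℕ) (p : Program)

/-- `Exec p s t s'`: started in `s`, the program `p` halts in `s'` after exactly `t` operations.
Each elementary operation and each test of a register counts as one operation. -/
inductive Exec : Program → Store → ℕ → Store → Prop where
  | op (o : Op) (s : Store) : Exec (.op o) s 1 (o.run s)
  | seq {p q : Program} {s s' s'' : Store} {t t' : ℕ} :
      Exec p s t s' → Exec q s' t' s'' → Exec (.seq p q) s (t + t') s''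
  | ifPos_pos {i : ℕ} {p q : Program} {s s' : Store} {t : ℕ} :
      0 < s.reg i → Exec p s t s' → Exec (.ifPos i p q) s (t + 1) s'
  | ifPos_zero {i : ℕ} {p q : Program} {s s' : Store} {t : ℕ} :
      s.reg i = 0 → Exec q s t s' → Exec (.ifPos i p q) s (t + 1) s'
  | whilePos_zero {i : ℕ} {p : Program} {s : Store} :
      s.reg i = 0 → Exec (.whilePos i p) s 1 s
  | whilePos_pos {i : ℕ} {p : Program} {s s' s'' : Store} {t t' : ℕ} :
      0 < s.reg i → Exec p s t s' → Exec (.whilePos i p) s' t' s'' →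
      Exec (.whilePos i p) s (t + t' + 1) s''

/-! ### Graphs and vertex partitions as inputs and outputs -/

section Encoding

variable {n : ℕ}

/-- `L` lists the edges of `H`, each exactly once, in any order and with any order of the ends. -/
def IsEdgeList (H : SimpleGraph (Fin n)) (L : List (Fin n × Fin n)) : Prop :=
  (L.map fun p => s(p.1, p.2)).Nodup ∧
    ∀ e : Sym2 (Fin n), e ∈ (L.map fun p => s(p.1, p.2)) ↔ e ∈ H.edgeSet

/-- The labels `a u` tell in which part of `A` a vertex lies: two vertices have the same label if
and only if they lie in the same part. -/
def IsLabelling (a : Fin n → Fin n) (A : Finpartition (Finset.univ : Finset (Fin n))) : Prop :=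
  ∀ u v : Fin n, a u = a v ↔ ∃ P ∈ A.parts, u ∈ P ∧ v ∈ P

/-- The initial configuration for a graph with vertex set `Fin n` and edge list `L` and a
partition with labels `a`: the registers `0` and `1` hold the numbers of vertices and of edges, the
memory holds the labels of the vertices followed by the ends of the edges, and everything
else is `0`. -/
def inputStore (L : List (Fin n × Fin n)) (a : Fin n → Fin n) : Store where
  reg i := if i = 0 then n else if i = 1 then L.length else 0
  mem i := (List.ofFn (fun u => (a u : ℕ)) ++
    L.flatMap fun p => [(p.1 : ℕ), (p.2 : ℕ)]).getD i 0

/-- In the final configuration `s` the memory cells `0, …, n - 1` hold labels for `A`. -/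
def IsOutput (s : Store) (A : Finpartition (Finset.univ : Finset (Fin n))) : Prop :=
  ∃ a : Fin n → Fin n, IsLabelling a A ∧ ∀ u : Fin n, s.mem u = a u

/-- Given only the graph `H` and the partition `A` (in any encoding), the program `p` halts after
at most `T` operations and outputs a partition that satisfies `good`. -/
def FindsWithin (p : Program) (T : ℕ) (H : SimpleGraph (Fin n))
    (A : Finpartition (Finset.univ : Finset (Fin n)))
    (good : Finpartition (Finset.univ : Finset (Fin n)) → Prop) : Prop :=
  ∀ (L : List (Fin n × Fin n)) (a : Fin n → Fin n), IsEdgeList H L → IsLabelling a A →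
    ∃ (t : ℕ) (s : Store) (A' : Finpartition (Finset.univ : Finset (Fin n))),
      t ≤ T ∧ Exec p (inputStore L a) t s ∧ IsOutput s A' ∧ good A'

end Encoding

end GraphModularity

/-!
Let `b = c n`. If `G` has at most `b` edges, the search returns `G` itself; otherwise it returns a
uniformly random set of `b` edges. The proof compares `G` with the sampled graph `H` in two steps.

*Concentration.* By an exponential supermartingale along the search (`searchLoop_mgf_le`, resting
on the one-step bound `exp_step_le`), the number of sampled edges in a fixed set `T` of edges of `G`
deviates from its mean by `η b` with probability at most `2 exp (-η² b / 4)`. For large `c` this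
beats the union bound over the `2 ^ n` vertex sets `S`, with `T` the set of edges inside `S`. So
with high probability all vertex sets have nearly the same proportion of inner edges in `G` and in
`H`. Volumes are determined by these proportions for `S` and its complement (`relVolume_eq`), hence
the scores of all partitions with at most `k` parts are nearly the same in `G` and in `H`
(`edgeLimitedSearch_close`).

*Merging.* Partitions with at most `k` parts suffice: go through the parts in any order and fill
bins, closing a bin as soon as its relative volume exceeds `1 / k`. At most `k` bins are used
(`card_image_binOf_le`). Merging keeps the inner edges, and the sum of the squared volumes grows by
at most `2 / k`, because each part joins a bin of relative volume at most `1 / k`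
(`modScore_le_binLabel`). Thus the scores of bounded partitions and the maximal scores agree in `G`
and `H` up to `O(η k + 1 / k)`. Merging according to the volumes in `H` is also the algorithm:
`mergeProgram` does it in three passes over the input, with a number of additions and subtractions
per step that depends on `k` only.
-/

namespace GraphModularity

/-! ### The law of the set of edges found by the search -/

section Law

open scoped ENNReal

variable {n : ℕ}

/-- Expectations under a mixture are averages of expectations. -/
theorem tsum_bind_mul {α β : Type*} (p : PMF α) (k : α → PMF β) (g : β → ℝ≥0∞) :
    ∑' y, (p.bind k) y * g y = ∑' x, p x * ∑' y, k x y * g y := by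
  simp only [PMF.bind_apply, ← ENNReal.tsum_mul_right, ← ENNReal.tsum_mul_left]
  rw [ENNReal.tsum_comm]
  simp only [mul_assoc]

open scoped Classical in
theorem searchLoop_of_pos (G : SimpleGraph (Fin n)) {b : ℝ} {Q F : Finset (Sym2 (Fin n))}
    (hQ : Q.Nonempty) (hF : (F.card : ℝ) < b) :
    haveI : Nonempty {e // e ∈ Q} := hQ.to_subtype
    searchLoop G b Q F = (PMF.uniformOfFintype {e // e ∈ Q}).bind fun e =>
      searchLoop G b (Q.erase e.1) (if e.1 ∈ G.edgeSet then insert e.1 F else F) := by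
  rw [searchLoop, dif_pos ⟨hQ, hF⟩]

theorem searchLoop_of_neg (G : SimpleGraph (Fin n)) {b : ℝ} {Q F : Finset (Sym2 (Fin n))}
    (h : ¬ (Q.Nonempty ∧ (F.card : ℝ) < b)) :
    searchLoop G b Q F = PMF.pure F := by
  rw [searchLoop, dif_neg h]

/-- The search only adds queried edges to `F`, stops with exactly `N` edges if it does not run out
of pairs, and otherwise finds every edge. -/
theorem searchLoop_support (G : SimpleGraph (Fin n)) (N : ℕ) (Q F F' : Finset (Sym2 (Fin n)))
    (hF : F.card ≤ N) (h : F' ∈ (searchLoop G N Q F).support) :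
    F ⊆ F' ∧ (∀ e ∈ F', e ∈ F ∨ e ∈ Q ∧ e ∈ G.edgeSet) ∧ F'.card ≤ N ∧
      (F'.card = N ∨ ∀ e ∈ Q, e ∈ G.edgeSet → e ∈ F') := by
  classical
  induction hc : Q.card generalizing Q F with
  | zero =>
    obtain rfl := Finset.card_eq_zero.1 hc
    rw [searchLoop_of_neg G (by simp), PMF.support_pure, Set.mem_singleton_iff] at h
    subst h
    simp_all
  | succ k ih =>
    by_cases hlt : F.card < N
    · have hQ : Q.Nonempty := Finset.card_pos.1 (by omega)
      have : Nonempty {e // e ∈ Q} := hQ.to_subtype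
      rw [searchLoop_of_pos G hQ (by exact_mod_cast hlt), PMF.mem_support_bind_iff] at h
      obtain ⟨⟨e, he⟩, -, h⟩ := h
      have hcard : (Q.erase e).card = k := by rw [Finset.card_erase_of_mem he]; omega
      dsimp only at h
      split_ifs at h with heG
      · obtain ⟨h1, h2, h3, h4⟩ :=
          ih _ _ ((Finset.card_insert_le _ _).trans (by omega)) h hcard
        refine ⟨(Finset.subset_insert _ _).trans h1, fun x hx => ?_, h3,
          h4.imp id fun h4 x hx => ?_⟩
        · rcases h2 x hx with h | h
          · rcases Finset.mem_insert.1 h with rfl | h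
            · exact .inr ⟨he, heG⟩
            · exact .inl h
          · exact .inr ⟨Finset.mem_of_mem_erase h.1, h.2⟩
        · intro hxG
          by_cases hxe : x = e
          · exact hxe ▸ h1 (Finset.mem_insert_self _ _)
          · exact h4 x (Finset.mem_erase.2 ⟨hxe, hx⟩) hxG
      · obtain ⟨h1, h2, h3, h4⟩ := ih _ _ hF h hcard
        refine ⟨h1, fun x hx => ?_, h3, h4.imp id fun h4 x hx hxG => ?_⟩
        · exact (h2 x hx).imp id fun h => ⟨Finset.mem_of_mem_erase h.1, h.2⟩
        · exact h4 x (Finset.mem_erase.2 ⟨fun hxe => heG (hxe ▸ hxG), hx⟩) hxG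
    · rw [searchLoop_of_neg G (fun h => hlt (by exact_mod_cast h.2)), PMF.support_pure,
        Set.mem_singleton_iff] at h
      subst h
      exact ⟨subset_rfl, fun e he => .inl he, hF, .inl (by omega)⟩

/-- A weak form of Hoeffding's lemma for a centred two-point variable. -/
theorem two_point_mgf_le {p a x : ℝ} (hp0 : 0 ≤ p) (hp1 : p ≤ 1) (ha0 : 0 ≤ a) (ha1 : a ≤ 1)
    (hx : |x| ≤ 1) :
    p * Real.exp (x * a * (1 - p)) + (1 - p) * Real.exp (-(x * a * p)) ≤ Real.exp (x ^ 2) := by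
  have key : ∀ y : ℝ, |y| ≤ 1 → Real.exp y ≤ 1 + y + y ^ 2 := fun y hy => by
    have := (abs_le.1 (Real.abs_exp_sub_one_sub_id_le hy)).2
    linarith
  have hxa : |x * a| ≤ 1 := by
    rw [abs_mul, abs_of_nonneg ha0]; exact mul_le_one₀ hx ha0 ha1
  have h1 := key (x * a * (1 - p)) (by
    rw [abs_mul, abs_of_nonneg (sub_nonneg.2 hp1)]
    exact mul_le_one₀ hxa (by linarith) (by linarith))
  have h2 := key (-(x * a * p)) (by
    rw [abs_neg, abs_mul, abs_of_nonneg hp0]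
    exact mul_le_one₀ hxa hp0 hp1)
  have h3 : (x * a) ^ 2 * (p * (1 - p)) ≤ x ^ 2 * 1 := by
    have : p * (1 - p) ≤ 1 := by nlinarith
    have h4 : (x * a) ^ 2 ≤ x ^ 2 := by
      rw [mul_pow]
      exact mul_le_of_le_one_right (sq_nonneg x) (pow_le_one₀ ha0 ha1)
    exact mul_le_mul h4 this (mul_nonneg hp0 (by linarith)) (sq_nonneg x)
  have h4 := Real.add_one_le_exp (x ^ 2)
  have h5 := mul_le_mul_of_nonneg_left h1 hp0
  have h6 := mul_le_mul_of_nonneg_left h2 (sub_nonneg.2 hp1)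
  nlinarith

/-- One draw without replacement from `r` edges of which `t` are marked, `d` draws to go: the
exponential bound is a supermartingale. -/
theorem exp_step_le {d r t : ℕ} (hd : 0 < d) (hdr : d ≤ r) (htr : t ≤ r) {x : ℝ} (hx : |x| ≤ 1) :
    t * Real.exp (x + x * (((d - 1 : ℕ) : ℝ) * ((t - 1 : ℕ) : ℝ) / ((r - 1 : ℕ) : ℝ)) +
        ((d - 1 : ℕ) : ℝ) * x ^ 2) +
      (r - t) * Real.exp (x * (((d - 1 : ℕ) : ℝ) * (t : ℝ) / ((r - 1 : ℕ) : ℝ)) +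
        ((d - 1 : ℕ) : ℝ) * x ^ 2) ≤
      r * Real.exp (x * ((d : ℝ) * (t : ℝ) / r) + d * x ^ 2) := by
  obtain ⟨d, rfl⟩ : ∃ d', d = d' + 1 := ⟨d - 1, by omega⟩
  obtain ⟨r, rfl⟩ : ∃ r', r = r' + 1 := ⟨r - 1, by omega⟩
  simp only [Nat.add_sub_cancel]
  have hr1 : (0 : ℝ) < ((r + 1 : ℕ) : ℝ) := by positivity
  have hdr' : (d : ℝ) ≤ r := by exact_mod_cast (by omega : d ≤ r)
  have htr' : (t : ℝ) ≤ ((r + 1 : ℕ) : ℝ) := by exact_mod_cast htr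
  set p : ℝ := t / ((r + 1 : ℕ) : ℝ) with hp
  set a : ℝ := 1 - d / r with ha
  have hdr1 : (d : ℝ) / r ≤ 1 := div_le_one_of_le₀ hdr' (by positivity)
  have hmgf := two_point_mgf_le (p := p) (a := a) (x := x) (by positivity)
    (div_le_one_of_le₀ htr' hr1.le) (by linarith)
    (by have : (0:ℝ) ≤ d / r := by positivity
        linarith) hx
  have htp : (t : ℝ) = p * ((r + 1 : ℕ) : ℝ) := by rw [hp]; field_simp
  set C : ℝ := x * (((d + 1 : ℕ) : ℝ) * (t : ℝ) / ((r + 1 : ℕ) : ℝ)) + d * x ^ 2 with hC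
  -- both exponents differ from that of the bound by the centred increment and `x ^ 2`
  have e2 : x * ((d : ℝ) * (t : ℝ) / (r : ℝ)) + d * x ^ 2 = C + -(x * a * p) := by
    rw [hC, ha, hp]
    rcases Nat.eq_zero_or_pos r with rfl | hr
    · have : d = 0 := by omega
      subst this
      simp
    · have : (r : ℝ) ≠ 0 := by positivity
      push_cast
      field_simp
      ring
  have e1 : t * Real.exp (x + x * ((d : ℝ) * ((t - 1 : ℕ) : ℝ) / (r : ℝ)) + d * x ^ 2) =
      t * Real.exp (C + x * a * (1 - p)) := by
    rcases Nat.eq_zero_or_pos t with rfl | ht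
    · simp
    · congr 2
      have : C + x * a * (1 - p) = (C + -(x * a * p)) + x * a := by ring
      rw [this, ← e2, ha, Nat.cast_sub (by omega : 1 ≤ t)]
      push_cast
      ring
  have e3 : x * (((d + 1 : ℕ) : ℝ) * (t : ℝ) / ((r + 1 : ℕ) : ℝ)) + ((d + 1 : ℕ) : ℝ) * x ^ 2 =
      C + x ^ 2 := by rw [hC]; push_cast; ring
  rw [e1, e2, e3, Real.exp_add C, Real.exp_add C, Real.exp_add C]
  calc _ = ((r + 1 : ℕ) : ℝ) * Real.exp C *
        (p * Real.exp (x * a * (1 - p)) + (1 - p) * Real.exp (-(x * a * p))) := by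
        linear_combination (Real.exp C * (Real.exp (x * a * (1 - p)) -
          Real.exp (-(x * a * p)))) * htp
    _ ≤ ((r + 1 : ℕ) : ℝ) * Real.exp C * Real.exp (x ^ 2) := by gcongr
    _ = _ := by ring

open scoped Classical in
/-- The moment generating function of the number of edges found in a set `T` of edges of `G`, from an
intermediate state of the search with at least `N - |F|` edges left. A query of a non-edge does not
change the bound, and for a query of an edge `exp_step_le` applies, so induction on the number of
pairs left works without any reference to the law of the found set. -/
theorem searchLoop_mgf_le (G : SimpleGraph (Fin n)) (N : ℕ) {T : Finset (Sym2 (Fin n))}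
    (hT : ∀ e ∈ T, e ∈ G.edgeSet) {x : ℝ} (hx : |x| ≤ 1) (Q F : Finset (Sym2 (Fin n)))
    (hQF : Disjoint Q F) (hN : N - F.card ≤ (Q.filter (· ∈ G.edgeSet)).card) :
    ∑' F', searchLoop G N Q F F' * ENNReal.ofReal (Real.exp (x * (F' ∩ T).card)) ≤
      ENNReal.ofReal (Real.exp (x * (F ∩ T).card +
        (x * (((N - F.card : ℕ) : ℝ) * ((Q ∩ T).card : ℝ) / (Q.filter (· ∈ G.edgeSet)).card)
          + ((N - F.card : ℕ) : ℝ) * x ^ 2))) := by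
  induction hc : Q.card generalizing Q F with
  | zero =>
    obtain rfl := Finset.card_eq_zero.1 hc
    rw [searchLoop_of_neg G (by simp)]
    have h0 : N - F.card = 0 := by simpa using hN
    rw [tsum_eq_single F (by intro F' hF'; simp [PMF.pure_apply, hF'])]
    simp [h0]
  | succ k ih =>
    by_cases hlt : F.card < N
    swap
    · rw [searchLoop_of_neg G (fun h => hlt (by exact_mod_cast h.2))]
      have h0 : N - F.card = 0 := by omega
      rw [tsum_eq_single F (by intro F' hF'; simp [PMF.pure_apply, hF'])]
      simp [h0]
    have hQ : Q.Nonempty := Finset.card_pos.1 (by omega)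
    have : Nonempty {e // e ∈ Q} := hQ.to_subtype
    rw [searchLoop_of_pos G hQ (by exact_mod_cast hlt), tsum_bind_mul, tsum_fintype]
    set d := N - F.card with hd
    set E := Q.filter (· ∈ G.edgeSet) with hE
    set s : ℝ := x * (F ∩ T).card with hs
    set B := Real.exp (s + (x * ((d : ℝ) * ((Q ∩ T).card : ℝ) / E.card) + d * x ^ 2)) with hB
    set B1 := Real.exp (s + (x + x * (((d - 1 : ℕ) : ℝ) * (((Q ∩ T).card - 1 : ℕ) : ℝ) /
      ((E.card - 1 : ℕ) : ℝ)) + ((d - 1 : ℕ) : ℝ) * x ^ 2)) with hB1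
    set B2 := Real.exp (s + (x * (((d - 1 : ℕ) : ℝ) * ((Q ∩ T).card : ℝ) /
      ((E.card - 1 : ℕ) : ℝ)) + ((d - 1 : ℕ) : ℝ) * x ^ 2)) with hB2
    -- the bound after the query of `e`
    set v : Sym2 (Fin n) → ℝ := fun e => if e ∈ T then B1 else if e ∈ G.edgeSet then B2 else B
      with hv
    have hstep : ∀ e ∈ Q, ∑' F', searchLoop G N (Q.erase e)
        (if e ∈ G.edgeSet then insert e F else F) F' *
          ENNReal.ofReal (Real.exp (x * (F' ∩ T).card)) ≤ ENNReal.ofReal (v e) := by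
      intro e he
      have hcard : (Q.erase e).card = k := by rw [Finset.card_erase_of_mem he]; omega
      have heF : e ∉ F := Finset.disjoint_left.1 hQF he
      have hfil : (Q.erase e).filter (· ∈ G.edgeSet) = E.erase e := by
        rw [hE, Finset.filter_erase]
      by_cases heG : e ∈ G.edgeSet
      · have heE : e ∈ E := Finset.mem_filter.2 ⟨he, heG⟩
        have hci : N - (insert e F).card = d - 1 := by
          rw [Finset.card_insert_of_notMem heF]; omega
        have hEc : (E.erase e).card = E.card - 1 := Finset.card_erase_of_mem heE
        have hdis : Disjoint (Q.erase e) (insert e F) := by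
          rw [Finset.disjoint_insert_right]
          exact ⟨Finset.notMem_erase _ _, hQF.mono_left (Finset.erase_subset _ _)⟩
        rw [if_pos heG]
        refine (ih (Q.erase e) (insert e F) hdis (by rw [hci, hfil, hEc]; omega) hcard).trans
          (ENNReal.ofReal_le_ofReal ?_)
        rw [hci, hfil, hEc, Finset.erase_inter]
        by_cases heT : e ∈ T
        · rw [Finset.insert_inter_of_mem heT, Finset.card_insert_of_notMem (by simp [heF]),
            Finset.card_erase_of_mem (Finset.mem_inter.2 ⟨he, heT⟩)]
          simp only [hv, if_pos heT, hB1, hs]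
          apply le_of_eq
          congr 1
          push_cast
          ring
        · rw [Finset.insert_inter_of_notMem heT, Finset.erase_eq_of_notMem (by simp [heT])]
          simp only [hv, if_neg heT, if_pos heG, hB2, hs]
          exact le_rfl
      · have heT : e ∉ T := fun h => heG (hT e h)
        have heE : e ∉ E := fun h => heG (Finset.mem_filter.1 h).2
        rw [if_neg heG]
        refine (ih (Q.erase e) F (hQF.mono_left (Finset.erase_subset _ _))
          (by rw [hfil, Finset.erase_eq_of_notMem heE]; exact hN) hcard).trans
          (ENNReal.ofReal_le_ofReal ?_)
        rw [hfil, Finset.erase_eq_of_notMem heE, Finset.erase_inter,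
          Finset.erase_eq_of_notMem (by simp [heT])]
        simp only [hv, if_neg heT, if_neg heG, hB, hs]
        exact le_rfl
    have hTE : Q ∩ T ⊆ E := fun e he => by
      rw [Finset.mem_inter] at he
      exact Finset.mem_filter.2 ⟨he.1, hT e he.2⟩
    have hEQ : E ⊆ Q := Finset.filter_subset _ _
    have hsum : ∑ e ∈ Q, v e = (Q ∩ T).card * B1 + (E.card - (Q ∩ T).card) * B2
        + (Q.card - E.card) * B := by
      rw [← Finset.sum_sdiff hEQ, ← Finset.sum_sdiff hTE]
      have h1 : ∑ e ∈ Q ∩ T, v e = (Q ∩ T).card * B1 := by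
        rw [← nsmul_eq_mul, ← Finset.sum_const]
        exact Finset.sum_congr rfl fun e he => by simp [hv, (Finset.mem_inter.1 he).2]
      have h2 : ∑ e ∈ E \ (Q ∩ T), v e = (E.card - (Q ∩ T).card) * B2 := by
        rw [← Nat.cast_sub (Finset.card_le_card hTE), ← Finset.card_sdiff_of_subset hTE,
          ← nsmul_eq_mul, ← Finset.sum_const]
        refine Finset.sum_congr rfl fun e he => ?_
        simp only [hE, Finset.mem_sdiff, Finset.mem_filter, Finset.mem_inter, not_and] at he
        simp only [hv]
        rw [if_neg (he.2 he.1.1), if_pos he.1.2]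
      have h3 : ∑ e ∈ Q \ E, v e = (Q.card - E.card) * B := by
        rw [← Nat.cast_sub (Finset.card_le_card hEQ), ← Finset.card_sdiff_of_subset hEQ,
          ← nsmul_eq_mul, ← Finset.sum_const]
        refine Finset.sum_congr rfl fun e he => ?_
        simp only [hE, Finset.mem_sdiff, Finset.mem_filter, not_and] at he
        simp only [hv]
        rw [if_neg (fun h => he.2 he.1 (hT e h)), if_neg (he.2 he.1)]
      rw [h1, h2, h3]
      ring
    have hreal : ∑ e ∈ Q, v e ≤ Q.card * B := by
      have := exp_step_le (d := d) (r := E.card) (t := (Q ∩ T).card) (by omega) hN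
        (Finset.card_le_card hTE) hx
      have h2 := mul_le_mul_of_nonneg_left this (Real.exp_pos s).le
      rw [hsum, hB1, hB2, hB]
      simp only [Real.exp_add s]
      nlinarith
    have hv0 : ∀ e, 0 ≤ v e := fun e => by
      simp only [hv]; split_ifs <;> positivity
    have hQ0 : (Q.card : ℝ≥0∞) ≠ 0 := by
      simpa using hQ.ne_empty
    calc _ ≤ ∑ e : {e // e ∈ Q}, (Q.card : ℝ≥0∞)⁻¹ * ENNReal.ofReal (v e) := by
          refine Finset.sum_le_sum fun e _ => ?_
          rw [PMF.uniformOfFintype_apply, Fintype.card_coe]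
          gcongr
          exact hstep e.1 e.2
      _ = (Q.card : ℝ≥0∞)⁻¹ * ENNReal.ofReal (∑ e ∈ Q, v e) := by
          rw [← Finset.mul_sum, ENNReal.ofReal_sum_of_nonneg fun e _ => hv0 e,
            Finset.sum_coe_sort Q fun e => ENNReal.ofReal (v e)]
      _ ≤ (Q.card : ℝ≥0∞)⁻¹ * (Q.card * ENNReal.ofReal B) := by
          gcongr
          rw [← ENNReal.ofReal_natCast, ← ENNReal.ofReal_mul (by positivity)]
          exact ENNReal.ofReal_le_ofReal hreal
      _ = ENNReal.ofReal B := by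
          rw [← mul_assoc, ENNReal.inv_mul_cancel hQ0 (by simp), one_mul]

end Law

/-! ### Tail bounds for the number of edges found -/

section Tail

open scoped ENNReal

variable {n : ℕ}

/-- The Chernoff bound, in the form of Markov's inequality for an exponential. -/
theorem toOuterMeasure_le_of_mgf {α : Type*} (p : PMF α) (g : α → ℝ) {B y : ℝ}
    (h : ∑' a, p a * ENNReal.ofReal (Real.exp (g a)) ≤ ENNReal.ofReal (Real.exp B)) :
    p.toOuterMeasure {a | y ≤ g a} ≤ ENNReal.ofReal (Real.exp (B - y)) := by
  have hle : p.toOuterMeasure {a | y ≤ g a} ≤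
      ∑' a, p a * ENNReal.ofReal (Real.exp (g a)) * ENNReal.ofReal (Real.exp (-y)) := by
    rw [PMF.toOuterMeasure_apply]
    refine ENNReal.tsum_le_tsum fun a => ?_
    by_cases ha : y ≤ g a
    · rw [Set.indicator_of_mem (by exact ha), mul_assoc,
        ← ENNReal.ofReal_mul (Real.exp_pos _).le, ← Real.exp_add]
      refine le_mul_of_one_le_right' ?_
      rw [ENNReal.one_le_ofReal, Real.one_le_exp_iff]
      linarith
    · rw [Set.indicator_of_notMem (by exact ha)]
      exact zero_le
  rw [ENNReal.tsum_mul_right] at hle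
  refine hle.trans ?_
  rw [sub_eq_add_neg, Real.exp_add, ENNReal.ofReal_mul (Real.exp_pos _).le]
  gcongr

open scoped Classical in
/-- If `N ≤ e(G)`, the number of edges found by the search in a set `T` of edges of `G` is within
`η N` of its mean up to an exponentially small probability. -/
theorem searchLoop_tail_le (G : SimpleGraph (Fin n)) {N : ℕ} (hN : N ≤ edgeCount G)
    {T : Finset (Sym2 (Fin n))} (hT : ∀ e ∈ T, e ∈ G.edgeSet) {η : ℝ} (hη0 : 0 < η) (hη1 : η ≤ 1) :
    (searchLoop G N (⊤ : SimpleGraph (Fin n)).edgeFinset ∅).toOuterMeasure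
        {F | η * N ≤ |((F ∩ T).card : ℝ) - N * T.card / edgeCount G|} ≤
      ENNReal.ofReal (2 * Real.exp (-(η ^ 2 * N / 4))) := by
  set p := searchLoop G N (⊤ : SimpleGraph (Fin n)).edgeFinset ∅
  have hE : ((⊤ : SimpleGraph (Fin n)).edgeFinset.filter (· ∈ G.edgeSet)) = G.edgeFinset := by
    ext e
    simp only [Finset.mem_filter, SimpleGraph.mem_edgeFinset, and_iff_right_iff_imp]
    exact fun h => SimpleGraph.edgeSet_mono le_top h
  have hm : edgeCount G = G.edgeFinset.card := by
    rw [edgeCount, ← SimpleGraph.coe_edgeFinset, Set.ncard_coe_finset]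
  have hTt : (⊤ : SimpleGraph (Fin n)).edgeFinset ∩ T = T := by
    refine Finset.inter_eq_right.2 fun e he => ?_
    rw [SimpleGraph.mem_edgeFinset]
    exact SimpleGraph.edgeSet_mono le_top (hT e he)
  have key : ∀ x : ℝ, |x| ≤ 1 → ∀ y : ℝ,
      p.toOuterMeasure {F | y + x * (N * T.card / edgeCount G) ≤ x * (F ∩ T).card} ≤
        ENNReal.ofReal (Real.exp (N * x ^ 2 - y)) := by
    intro x hx y
    have h := searchLoop_mgf_le G N hT hx (⊤ : SimpleGraph (Fin n)).edgeFinset ∅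
      (Finset.disjoint_empty_right _) (by rw [hE, ← hm]; simpa using hN)
    rw [hE, hTt, ← hm] at h
    refine (toOuterMeasure_le_of_mgf p _ h).trans (ENNReal.ofReal_le_ofReal ?_)
    simp only [Real.exp_le_exp, Finset.empty_inter, Finset.card_empty, Nat.cast_zero, mul_zero,
      Nat.sub_zero, zero_add]
    linarith
  -- `η / 2` minimizes `N x ^ 2 - x η N`
  have h1 := key (η / 2) (by rw [abs_of_pos (by positivity)]; linarith) (η ^ 2 * N / 2)
  have h2 := key (-(η / 2)) (by rw [abs_neg, abs_of_pos (by positivity)]; linarith) (η ^ 2 * N / 2)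
  calc _ ≤ p.toOuterMeasure
        ({F | η ^ 2 * N / 2 + η / 2 * (N * T.card / edgeCount G) ≤ η / 2 * (F ∩ T).card} ∪
          {F | η ^ 2 * N / 2 + -(η / 2) * (N * T.card / edgeCount G) ≤
            -(η / 2) * (F ∩ T).card}) := by
        refine MeasureTheory.measure_mono fun F hF => ?_
        rw [Set.mem_ofPred_eq, le_abs] at hF
        rcases hF with h | h
        · left
          have := mul_le_mul_of_nonneg_left h (half_pos hη0).le
          rw [Set.mem_ofPred_eq]
          nlinarith
        · right
          have := mul_le_mul_of_nonneg_left h (half_pos hη0).le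
          rw [Set.mem_ofPred_eq]
          nlinarith
    _ ≤ _ := (MeasureTheory.measure_union_le _ _).trans (add_le_add h1 h2)
    _ = _ := by
        rw [← ENNReal.ofReal_add (by positivity) (by positivity)]
        congr 1
        have e1 : N * (η / 2) ^ 2 - η ^ 2 * N / 2 = -(η ^ 2 * N / 4) := by ring
        have e2 : N * (-(η / 2)) ^ 2 - η ^ 2 * N / 2 = -(η ^ 2 * N / 4) := by ring
        rw [e1, e2]
        ring

end Tail

/-! ### Scores of partitions and densities of vertex sets -/

section Density

variable {n : ℕ}

open scoped Classical in
/-- The edges of `G` with both ends in `S`. -/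
noncomputable def innerEdges (G : SimpleGraph (Fin n)) (S : Finset (Fin n)) :
    Finset (Sym2 (Fin n)) :=
  G.edgeFinset.filter fun e => ∀ x ∈ e, x ∈ S

theorem mem_innerEdges {G : SimpleGraph (Fin n)} {S : Finset (Fin n)} {e : Sym2 (Fin n)} :
    e ∈ innerEdges G S ↔ e ∈ G.edgeSet ∧ ∀ x ∈ e, x ∈ S := by
  simp [innerEdges]

/-- The proportion of the edges of `G` that have both ends in `S`. -/
noncomputable def innerDensity (G : SimpleGraph (Fin n)) (S : Finset (Fin n)) : ℝ :=
  (innerEdges G S).card / edgeCount G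

open scoped Classical in
/-- The volume of `S`, that is, the sum of the degrees, relative to the volume of the graph. -/
noncomputable def relVolume (G : SimpleGraph (Fin n)) (S : Finset (Fin n)) : ℝ :=
  (∑ u ∈ S, (G.degree u : ℝ)) / (2 * edgeCount G)

open scoped Classical in
theorem edgeCount_eq_card (G : SimpleGraph (Fin n)) : edgeCount G = G.edgeFinset.card := by
  rw [edgeCount, ← SimpleGraph.coe_edgeFinset, Set.ncard_coe_finset]

open scoped Classical in
theorem sum_degree_eq (G : SimpleGraph (Fin n)) : ∑ u, (G.degree u : ℝ) = 2 * edgeCount G := by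
  rw [edgeCount_eq_card]
  exact_mod_cast G.sum_degrees_eq_twice_card_edges

open scoped Classical in
theorem degree_eq_sum (G : SimpleGraph (Fin n)) (u : Fin n) :
    (G.degree u : ℝ) = ∑ v, if G.Adj u v then (1 : ℝ) else 0 := by
  rw [Finset.sum_boole, ← SimpleGraph.card_neighborFinset_eq_degree,
    SimpleGraph.neighborFinset_eq_filter]

open scoped Classical in
/-- Every inner edge is counted at both of its ends. -/
theorem sum_adj_eq_two_mul_innerEdges (G : SimpleGraph (Fin n)) (S : Finset (Fin n)) :
    ∑ u ∈ S, ∑ v ∈ S, (if G.Adj u v then (1 : ℝ) else 0) = 2 * (innerEdges G S).card := by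
  let G' : SimpleGraph (Fin n) :=
    { Adj := fun u v => G.Adj u v ∧ u ∈ S ∧ v ∈ S
      symm := ⟨fun u v h => ⟨h.1.symm, h.2.2, h.2.1⟩⟩
      loopless := ⟨fun u h => G.loopless.irrefl u h.1⟩ }
  have h1 : (innerEdges G S : Set (Sym2 (Fin n))) = G'.edgeSet := by
    ext e
    induction e with
    | _ a b =>
      simp only [innerEdges, Finset.mem_coe, Finset.mem_filter, SimpleGraph.mem_edgeFinset,
        SimpleGraph.mem_edgeSet, Sym2.mem_iff, forall_eq_or_imp, forall_eq]
      rfl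
  rw [← Set.ncard_coe_finset, h1, ← edgeCount, ← sum_degree_eq]
  simp only [degree_eq_sum]
  have h2 : ∀ u ∉ S, ∀ v, ¬ G'.Adj u v := fun u hu v h => hu h.2.1
  have h3 : ∀ u, ∀ v ∉ S, ¬ G'.Adj u v := fun u v hv h => hv h.2.2
  refine Eq.trans (Finset.sum_congr rfl fun u hu => ?_) (Finset.sum_subset (Finset.subset_univ S)
    fun u _ hu => Finset.sum_eq_zero fun v _ => if_neg (h2 u hu v))
  refine Eq.trans (Finset.sum_congr rfl fun v hv => ?_) (Finset.sum_subset (Finset.subset_univ S)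
    fun v _ hv => if_neg (h3 u v hv))
  simp [G', hu, hv]

open scoped Classical in
theorem modScore_eq (G : SimpleGraph (Fin n))
    (A : Finpartition (Finset.univ : Finset (Fin n))) :
    modScore G A = ∑ P ∈ A.parts, (innerDensity G P - relVolume G P ^ 2) := by
  rw [modScore]
  split_ifs with hm
  · simp [innerDensity, relVolume, hm]
  · have hm' : (edgeCount G : ℝ) ≠ 0 := by exact_mod_cast hm
    rw [Finset.mul_sum]
    refine Finset.sum_congr rfl fun P _ => ?_
    simp only [Finset.sum_sub_distrib, ← Finset.sum_div]
    rw [sum_adj_eq_two_mul_innerEdges, ← Finset.sum_mul_sum, innerDensity, relVolume]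
    field_simp

open scoped Classical in
/-- The volume of a vertex set is determined by the numbers of edges inside the set and inside
its complement. -/
theorem relVolume_eq (G : SimpleGraph (Fin n)) (hm : edgeCount G ≠ 0) (S : Finset (Fin n)) :
    relVolume G S = (1 + innerDensity G S - innerDensity G Sᶜ) / 2 := by
  have hm' : (edgeCount G : ℝ) ≠ 0 := by exact_mod_cast hm
  set f : Fin n → Fin n → ℝ := fun u v => if G.Adj u v then 1 else 0 with hf
  have hsymm : ∑ u ∈ S, ∑ v ∈ Sᶜ, f u v = ∑ u ∈ Sᶜ, ∑ v ∈ S, f u v := by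
    rw [Finset.sum_comm]
    simp only [hf, G.adj_comm]
  have h1 := sum_adj_eq_two_mul_innerEdges G S
  have h2 := sum_adj_eq_two_mul_innerEdges G Sᶜ
  have h3 : ∀ U : Finset (Fin n), ∑ u ∈ U, (G.degree u : ℝ) =
      ∑ u ∈ U, ∑ v ∈ S, f u v + ∑ u ∈ U, ∑ v ∈ Sᶜ, f u v := fun U => by
    rw [← Finset.sum_add_distrib]
    refine Finset.sum_congr rfl fun u _ => ?_
    rw [degree_eq_sum, Finset.sum_add_sum_compl]
  have h4 := sum_degree_eq G
  rw [← Finset.sum_add_sum_compl S, h3, h3] at h4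
  rw [relVolume, innerDensity, innerDensity, h3]
  field_simp
  linarith

theorem relVolume_nonneg (G : SimpleGraph (Fin n)) (S : Finset (Fin n)) : 0 ≤ relVolume G S := by
  unfold relVolume; positivity

open scoped Classical in
theorem relVolume_le_one (G : SimpleGraph (Fin n)) (S : Finset (Fin n)) : relVolume G S ≤ 1 := by
  refine div_le_one_of_le₀ ?_ (by positivity)
  rw [← sum_degree_eq]
  exact Finset.sum_le_sum_of_subset_of_nonneg (Finset.subset_univ _) fun _ _ _ => by positivity

/-- If all vertex sets have almost the same proportion of inner edges in `G` and `H`, then the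
scores of partitions with a bounded number of parts are almost the same. -/
theorem abs_modScore_sub_le {G H : SimpleGraph (Fin n)} (hG : edgeCount G ≠ 0)
    (hH : edgeCount H ≠ 0) {η : ℝ}
    (h : ∀ S, |innerDensity H S - innerDensity G S| ≤ η)
    (A : Finpartition (Finset.univ : Finset (Fin n))) :
    |modScore H A - modScore G A| ≤ A.parts.card * (3 * η) := by
  rw [modScore_eq, modScore_eq, ← Finset.sum_sub_distrib, ← nsmul_eq_mul]
  refine (Finset.abs_sum_le_sum_abs _ _).trans (Finset.sum_le_card_nsmul _ _ _ fun P _ => ?_)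
  have hv : |relVolume H P - relVolume G P| ≤ η := by
    rw [relVolume_eq H hH, relVolume_eq G hG, abs_le]
    have h1 := abs_le.1 (h P)
    have h2 := abs_le.1 (h Pᶜ)
    constructor <;> linarith
  have hsq : |relVolume H P ^ 2 - relVolume G P ^ 2| ≤ 2 * η := by
    have h0 := relVolume_nonneg H P
    have h1 := relVolume_nonneg G P
    have h2 := relVolume_le_one H P
    have h3 := relVolume_le_one G P
    rw [sq_sub_sq, abs_mul, abs_of_nonneg (by linarith)]
    exact mul_le_mul (by linarith) hv (abs_nonneg _) (by norm_num)
  have h1 := abs_le.1 (h P)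
  have h2 := abs_le.1 hsq
  rw [abs_le]
  constructor <;> linarith

theorem modScore_le_modularity (G : SimpleGraph (Fin n))
    (A : Finpartition (Finset.univ : Finset (Fin n))) : modScore G A ≤ modularity G :=
  le_ciSup (Set.finite_range _).bddAbove A

theorem exists_modScore_eq_modularity (G : SimpleGraph (Fin n)) :
    ∃ A, modScore G A = modularity G := by
  have : Nonempty (Finpartition (Finset.univ : Finset (Fin n))) := ⟨⊥⟩
  exact exists_eq_ciSup_of_finite

end Density

/-! ### Merging the parts of a partition -/

section Merge

variable {n : ℕ}

open scoped Classical in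
/-- The partition into the sets of vertices with equal labels. -/
noncomputable def labelPartition (a : Fin n → Fin n) :
    Finpartition (Finset.univ : Finset (Fin n)) :=
  Finpartition.ofSetoid (Setoid.ker a)

theorem isLabelling_labelPartition (a : Fin n → Fin n) : IsLabelling a (labelPartition a) := by
  classical
  intro u v
  rw [labelPartition, ← Finpartition.mem_part_iff_exists, Finpartition.mem_part_ofSetoid_iff_rel,
    Setoid.ker_def, eq_comm]

theorem exists_isLabelling (A : Finpartition (Finset.univ : Finset (Fin n))) :
    ∃ a, IsLabelling a A := by
  have h : ∀ P : Finset (Fin n), P ∈ A.parts → ∃ x, x ∈ P := fun P hP =>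
    A.nonempty_of_mem_parts hP
  choose g hg using h
  have hp : ∀ u, A.part u ∈ A.parts := fun u => A.part_mem.2 (Finset.mem_univ u)
  refine ⟨fun u => g (A.part u) (hp u), fun u v => ⟨fun huv => ?_, ?_⟩⟩
  · have h1 := hg _ (hp u)
    have h2 := hg _ (hp v)
    dsimp only at huv
    rw [huv] at h1
    have := A.eq_of_mem_parts (hp u) (hp v) h1 h2
    exact ⟨_, hp u, A.mem_part_self.2 (Finset.mem_univ u),
      this ▸ A.mem_part_self.2 (Finset.mem_univ v)⟩
  · rintro ⟨P, hP, hu, hv⟩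
    have h1 := A.part_eq_of_mem hP hu
    have h2 := A.part_eq_of_mem hP hv
    simp only [h1, h2]

/-- The vertices with label `l`. -/
def labelClass (a : Fin n → Fin n) (l : Fin n) : Finset (Fin n) :=
  Finset.univ.filter fun u => a u = l

@[simp] theorem mem_labelClass {a : Fin n → Fin n} {l u : Fin n} :
    u ∈ labelClass a l ↔ a u = l := by
  simp [labelClass]

theorem labelClass_mem_parts {a : Fin n → Fin n}
    {A : Finpartition (Finset.univ : Finset (Fin n))} (h : IsLabelling a A) (u : Fin n) :
    labelClass a (a u) ∈ A.parts := by
  have : labelClass a (a u) = A.part u := by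
    ext v
    rw [mem_labelClass, h, Finpartition.mem_part_iff_exists]
  rw [this]
  exact A.part_mem.2 (Finset.mem_univ u)

theorem parts_eq_image {a : Fin n → Fin n}
    {A : Finpartition (Finset.univ : Finset (Fin n))} (h : IsLabelling a A) :
    A.parts = (Finset.univ.image a).image (labelClass a) := by
  ext P
  simp only [Finset.mem_image, Finset.mem_univ, true_and, exists_exists_eq_and]
  constructor
  · intro hP
    obtain ⟨u, hu⟩ := A.nonempty_of_mem_parts hP
    exact ⟨u, A.eq_of_mem_parts (labelClass_mem_parts h u) hP (mem_labelClass.2 rfl) hu⟩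
  · rintro ⟨u, rfl⟩
    exact labelClass_mem_parts h u

/-- The parts of a labelled partition are the nonempty label classes. -/
theorem sum_parts_eq_sum_labels {a : Fin n → Fin n}
    {A : Finpartition (Finset.univ : Finset (Fin n))} (h : IsLabelling a A)
    (g : Finset (Fin n) → ℝ) (hg : g ∅ = 0) :
    ∑ P ∈ A.parts, g P = ∑ l, g (labelClass a l) := by
  rw [parts_eq_image h, Finset.sum_image]
  · refine Finset.sum_subset (Finset.subset_univ _) fun l _ hl => ?_
    rw [show labelClass a l = ∅ from Finset.eq_empty_of_forall_notMem fun u hu => hl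
      (Finset.mem_image.2 ⟨u, Finset.mem_univ u, mem_labelClass.1 hu⟩), hg]
  · intro l hl l' _ hll
    obtain ⟨u, -, rfl⟩ := Finset.mem_image.1 (Finset.mem_coe.1 hl)
    exact mem_labelClass.1 (hll ▸ mem_labelClass.2 rfl)

theorem card_parts_le {a : Fin n → Fin n} {A : Finpartition (Finset.univ : Finset (Fin n))}
    (h : IsLabelling a A) : A.parts.card ≤ (Finset.univ.image a).card := by
  rw [parts_eq_image h]
  exact Finset.card_image_le

theorem modScore_eq_sum_labels (G : SimpleGraph (Fin n)) {a : Fin n → Fin n}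
    {A : Finpartition (Finset.univ : Finset (Fin n))} (h : IsLabelling a A) :
    modScore G A = ∑ l, innerDensity G (labelClass a l) - ∑ l, relVolume G (labelClass a l) ^ 2 := by
  classical
  rw [modScore_eq, sum_parts_eq_sum_labels h, Finset.sum_sub_distrib]
  have h1 : innerEdges G ∅ = ∅ := Finset.eq_empty_of_forall_notMem fun e he => by
    rw [mem_innerEdges] at he
    induction e with
    | _ x y => exact Finset.notMem_empty x (he.2 x (Sym2.mem_mk_left x y))
  simp [innerDensity, relVolume, h1]

/-- Merging label classes keeps all inner edges. -/
theorem sum_innerDensity_le_comp (G : SimpleGraph (Fin n)) (a f : Fin n → Fin n) :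
    ∑ l, innerDensity G (labelClass a l) ≤ ∑ j, innerDensity G (labelClass (f ∘ a) j) := by
  classical
  simp only [innerDensity, ← Finset.sum_div]
  refine div_le_div_of_nonneg_right ?_ (Nat.cast_nonneg _)
  norm_cast
  rw [← Finset.sum_fiberwise Finset.univ f]
  refine Finset.sum_le_sum fun j _ => ?_
  rw [← Finset.card_biUnion]
  · refine Finset.card_le_card fun e he => ?_
    obtain ⟨l, hl, he⟩ := Finset.mem_biUnion.1 he
    rw [mem_innerEdges] at he ⊢
    refine ⟨he.1, fun x hx => ?_⟩
    have := mem_labelClass.1 (he.2 x hx)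
    simp [this, (Finset.mem_filter.1 hl).2]
  · intro l _ l' _ hne
    refine Finset.disjoint_left.2 fun e he he' => hne ?_
    have he := mem_innerEdges.1 he
    have he' := mem_innerEdges.1 he'
    induction e with
    | _ x y =>
      exact (mem_labelClass.1 (he.2 x (Sym2.mem_mk_left x y))).symm.trans
        (mem_labelClass.1 (he'.2 x (Sym2.mem_mk_left x y)))

theorem relVolume_labelClass_comp (G : SimpleGraph (Fin n)) (a f : Fin n → Fin n) (j : Fin n) :
    relVolume G (labelClass (f ∘ a) j) =
      ∑ l ∈ Finset.univ.filter (f · = j), relVolume G (labelClass a l) := by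
  simp only [relVolume, ← Finset.sum_div]
  congr 1
  rw [← Finset.sum_fiberwise_of_maps_to (s := labelClass (f ∘ a) j)
    (t := Finset.univ.filter (f · = j)) (g := a) (fun u hu => by simpa using hu)]
  refine Finset.sum_congr rfl fun l hl => Finset.sum_congr ?_ fun _ _ => rfl
  ext u
  simp only [Finset.mem_filter, mem_labelClass, Function.comp, and_iff_right_iff_imp]
  rintro rfl
  exact (Finset.mem_filter.1 hl).2

theorem sum_relVolume_le_one (G : SimpleGraph (Fin n)) (a : Fin n → Fin n) :
    ∑ l, relVolume G (labelClass a l) ≤ 1 := by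
  refine le_trans (le_of_eq ?_) (relVolume_le_one G Finset.univ)
  simp only [relVolume, ← Finset.sum_div]
  congr 1
  exact Finset.sum_fiberwise Finset.univ a _

/-- A double sum over pairs in the same fibre of `f`, split at the diagonal: if the weights before
`l'` in the fibre of `l'` add up to at most `δ`, then merging the fibres increases the sum of the
squares by at most `2 δ`. -/
theorem sum_fiber_sq_le (f : Fin n → Fin n) (w : Fin n → ℝ) (hw : ∀ l, 0 ≤ w l)
    (hw1 : ∑ l, w l ≤ 1) {δ : ℝ} (hδ : 0 ≤ δ)
    (h : ∀ l', ∑ l ∈ Finset.univ.filter (fun l => l < l' ∧ f l = f l'), w l ≤ δ) :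
    ∑ j, (∑ l ∈ Finset.univ.filter (f · = j), w l) ^ 2 ≤ ∑ l, w l ^ 2 + 2 * δ := by
  set c : Fin n → Fin n → ℝ := fun l l' => if f l = f l' then w l * w l' else 0 with hc
  have h1 : ∑ j, (∑ l ∈ Finset.univ.filter (f · = j), w l) ^ 2 = ∑ l', ∑ l, c l l' := by
    rw [← Finset.sum_fiberwise Finset.univ f fun l' => ∑ l, c l l']
    refine Finset.sum_congr rfl fun j _ => ?_
    rw [sq, Finset.sum_mul_sum, Finset.sum_comm]
    refine Finset.sum_congr rfl fun l' hl' => ?_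
    rw [Finset.sum_filter]
    refine Finset.sum_congr rfl fun l _ => ?_
    simp only [hc, (Finset.mem_filter.1 hl').2]
  have h2 : ∀ l' l, c l l' = (if l = l' then w l' ^ 2 else 0) + (if l < l' then c l l' else 0) +
      (if l' < l then c l' l else 0) := by
    intro l' l
    have hcs : c l l' = c l' l := by simp only [hc, eq_comm, mul_comm]
    rcases lt_trichotomy l l' with h | rfl | h
    · simp [h, h.ne, h.not_gt]
    · simp [hc, sq]
    · simp [h, h.ne', h.not_gt, hcs]
  have h3 : ∀ l', ∑ l, (if l < l' then c l l' else 0) ≤ w l' * δ := by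
    intro l'
    refine le_trans (le_of_eq ?_) (mul_le_mul_of_nonneg_left (h l') (hw l'))
    rw [Finset.mul_sum, Finset.sum_filter]
    refine Finset.sum_congr rfl fun l _ => ?_
    simp only [hc, ite_and, mul_comm]
  have h4 : ∑ l', ∑ l, (if l < l' then c l l' else 0) ≤ δ := by
    refine (Finset.sum_le_sum fun l' _ => h3 l').trans ?_
    rw [← Finset.sum_mul]
    exact mul_le_of_le_one_left hδ hw1
  rw [h1, Finset.sum_congr rfl fun l' _ => Finset.sum_congr rfl fun l _ => h2 l' l]
  simp only [Finset.sum_add_distrib]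
  rw [Finset.sum_comm (f := fun l' l => if l' < l then c l' l else 0)]
  simp only [Finset.sum_ite_eq', Finset.mem_univ, if_true]
  linarith

/-- If every part is merged into a bin whose relative volume so far is at most `δ`, the score drops
by at most `2 δ`. -/
theorem modScore_le_comp_add (G : SimpleGraph (Fin n)) {a f : Fin n → Fin n}
    {A A' : Finpartition (Finset.univ : Finset (Fin n))} (hA : IsLabelling a A)
    (hA' : IsLabelling (f ∘ a) A') {δ : ℝ} (hδ : 0 ≤ δ)
    (h : ∀ l', ∑ l ∈ Finset.univ.filter (fun l => l < l' ∧ f l = f l'),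
      relVolume G (labelClass a l) ≤ δ) :
    modScore G A ≤ modScore G A' + 2 * δ := by
  rw [modScore_eq_sum_labels G hA, modScore_eq_sum_labels G hA']
  simp only [relVolume_labelClass_comp]
  have h1 := sum_innerDensity_le_comp G a f
  have h2 := sum_fiber_sq_le f (fun l => relVolume G (labelClass a l))
    (fun l => relVolume_nonneg G _) (sum_relVolume_le_one G a) hδ h
  linarith

end Merge

/-! ### Filling bins in the order of the labels -/

section Bins

/-- The bins are filled greedily with items of volumes `v 0, v 1, …`. After `l` items, the state
consists of the volume of the current bin and of its name, which is the number of its first item.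
A bin is closed as soon as `k` times its volume is larger than `M`. -/
def binState (k M : ℕ) (v : ℕ → ℕ) : ℕ → ℕ × ℕ
  | 0 => (0, 0)
  | l + 1 =>
    if M < k * (binState k M v l).1 then (v l, l)
    else ((binState k M v l).1 + v l, (binState k M v l).2)

/-- The name of the bin into which item `l` is put. -/
def binOf (k M : ℕ) (v : ℕ → ℕ) (l : ℕ) : ℕ := (binState k M v (l + 1)).2

variable {k M : ℕ} {v : ℕ → ℕ}

theorem binState_snd_le (l : ℕ) : (binState k M v l).2 ≤ l := by
  induction l with
  | zero => simp [binState]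
  | succ l ih =>
    rw [binState]
    split_ifs
    · exact Nat.le_succ l
    · exact ih.trans (Nat.le_succ l)

theorem binOf_le (l : ℕ) : binOf k M v l ≤ l := by
  unfold binOf
  rw [binState]
  split_ifs
  · exact le_rfl
  · exact binState_snd_le l

theorem binState_fst_eq (l : ℕ) : (binState k M v l).1 =
    ∑ j ∈ (Finset.range l).filter (fun j => binOf k M v j = (binState k M v l).2), v j := by
  induction l with
  | zero => rw [Finset.range_zero, Finset.filter_empty, Finset.sum_empty, binState]
  | succ l ih =>
    rw [Finset.range_add_one, Finset.filter_insert, if_pos (by rfl), Finset.sum_insert (by simp)]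
    by_cases h : M < k * (binState k M v l).1
    · have h1 : binState k M v (l + 1) = (v l, l) := by rw [binState, if_pos h]
      rw [h1, Finset.filter_false_of_mem]
      · simp
      · intro j hj
        have := binOf_le (k := k) (M := M) (v := v) j
        have := Finset.mem_range.1 hj
        dsimp only
        omega
    · have h1 : binState k M v (l + 1) = ((binState k M v l).1 + v l, (binState k M v l).2) := by
        rw [binState, if_neg h]
      rw [h1, ← ih, add_comm]

/-- When an item is put into a bin, the bin is not closed yet. -/
theorem mul_sum_binOf_le (l : ℕ) :
    k * ∑ j ∈ (Finset.range l).filter (fun j => binOf k M v j = binOf k M v l), v j ≤ M := by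
  by_cases h : M < k * (binState k M v l).1
  · have h1 : binOf k M v l = l := by rw [binOf, binState, if_pos h]
    rw [Finset.filter_false_of_mem]
    · simp
    · intro j hj
      have := binOf_le (k := k) (M := M) (v := v) j
      have := Finset.mem_range.1 hj
      omega
  · have h1 : binOf k M v l = (binState k M v l).2 := by rw [binOf, binState, if_neg h]
    rw [h1, ← binState_fst_eq]
    exact not_lt.1 h

theorem exists_card_image_binOf_le (l : ℕ) :
    ∃ c, (insert (binState k M v l).2 ((Finset.range l).image (binOf k M v))).card ≤ c + 1 ∧
      c * (M + 1) + k * (binState k M v l).1 ≤ k * ∑ j ∈ Finset.range l, v j := by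
  -- `c` bins are closed, each of which has `k` times its volume at least `M + 1`
  induction l with
  | zero => exact ⟨0, by simp, by simp [binState]⟩
  | succ l ih =>
    obtain ⟨c, hc, hs⟩ := ih
    have h0 : insert (binState k M v (l + 1)).2 ((Finset.range (l + 1)).image (binOf k M v)) =
        insert (binState k M v (l + 1)).2 ((Finset.range l).image (binOf k M v)) := by
      rw [Finset.range_add_one, Finset.image_insert]
      exact Finset.insert_idem _ _
    rw [h0, Finset.sum_range_succ, mul_add]
    by_cases h : M < k * (binState k M v l).1
    · have h1 : binState k M v (l + 1) = (v l, l) := by rw [binState, if_pos h]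
      rw [h1]
      refine ⟨c + 1, (Finset.card_insert_le _ _).trans (Nat.succ_le_succ ?_), ?_⟩
      · exact (Finset.card_le_card (Finset.subset_insert _ _)).trans hc
      · dsimp only
        rw [add_mul]
        omega
    · have h1 : binState k M v (l + 1) = ((binState k M v l).1 + v l, (binState k M v l).2) := by
        rw [binState, if_neg h]
      rw [h1]
      refine ⟨c, hc, ?_⟩
      dsimp only
      rw [Nat.mul_add k (binState k M v l).1]
      omega

/-- Closed bins have volume more than `M / k`, so at most `k` bins are used. -/
theorem card_image_binOf_le (hk : 0 < k) {n : ℕ} (hM : ∑ j ∈ Finset.range n, v j ≤ M) :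
    ((Finset.range n).image (binOf k M v)).card ≤ k := by
  obtain ⟨c, hc, hs⟩ := exists_card_image_binOf_le (k := k) (M := M) (v := v) n
  have h1 : c * (M + 1) < k * (M + 1) := by
    have := Nat.mul_le_mul_left k hM
    calc _ ≤ k * M := by omega
      _ < _ := by rw [mul_add]; omega
  have h2 := Nat.lt_of_mul_lt_mul_right h1
  have h3 := Finset.card_le_card (Finset.subset_insert (binState k M v n).2
    ((Finset.range n).image (binOf k M v)))
  omega

variable {n : ℕ}

/-- The greedy bins as a map of labels in `Fin n`. -/
def binLabel (k M : ℕ) (v : ℕ → ℕ) (l : Fin n) : Fin n :=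
  ⟨binOf k M v l, (binOf_le _).trans_lt l.2⟩

open scoped Classical in
/-- The volume of the vertices with label `l`. -/
noncomputable def labelVolume (G : SimpleGraph (Fin n)) (a : Fin n → Fin n) (l : ℕ) : ℕ :=
  ∑ u ∈ Finset.univ.filter (fun u => (a u : ℕ) = l), G.degree u

open scoped Classical in
theorem relVolume_labelClass (G : SimpleGraph (Fin n)) (a : Fin n → Fin n) (l : Fin n) :
    relVolume G (labelClass a l) = labelVolume G a l / (2 * edgeCount G) := by
  rw [relVolume, labelVolume, labelClass]
  push_cast
  simp only [Fin.ext_iff]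

open scoped Classical in
theorem sum_labelVolume (G : SimpleGraph (Fin n)) (a : Fin n → Fin n) :
    ∑ l ∈ Finset.range n, labelVolume G a l = 2 * edgeCount G := by
  simp only [labelVolume]
  rw [Finset.sum_fiberwise_of_maps_to (fun u _ => Finset.mem_range.2 (a u).2),
    edgeCount_eq_card, ← SimpleGraph.sum_degrees_eq_twice_card_edges]

theorem card_parts_binLabel_le (G : SimpleGraph (Fin n)) (hk : 0 < k) {a : Fin n → Fin n}
    {A' : Finpartition (Finset.univ : Finset (Fin n))}
    (hA' : IsLabelling (binLabel k (2 * edgeCount G) (labelVolume G a) ∘ a) A') :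
    A'.parts.card ≤ k := by
  refine (card_parts_le hA').trans ?_
  rw [← Finset.card_image_of_injective _ Fin.val_injective]
  refine (Finset.card_le_card fun x hx => ?_).trans
    (card_image_binOf_le hk (sum_labelVolume G a).le)
  simp only [Finset.mem_image, Finset.mem_univ, true_and, exists_exists_eq_and] at hx
  obtain ⟨u, rfl⟩ := hx
  exact Finset.mem_image.2 ⟨a u, Finset.mem_range.2 (a u).2, rfl⟩

/-- Greedy merging costs little in the score. -/
theorem modScore_le_binLabel (G : SimpleGraph (Fin n)) (hk : 0 < k) {a : Fin n → Fin n}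
    {A A' : Finpartition (Finset.univ : Finset (Fin n))} (hA : IsLabelling a A)
    (hA' : IsLabelling (binLabel k (2 * edgeCount G) (labelVolume G a) ∘ a) A') :
    modScore G A ≤ modScore G A' + 2 * (1 / k) := by
  refine modScore_le_comp_add G hA hA' (by positivity) fun l' => ?_
  simp only [relVolume_labelClass, ← Finset.sum_div]
  refine div_le_of_le_mul₀ (by positivity) (by positivity) ?_
  rw [one_div_mul_eq_div, le_div_iff₀' (by exact_mod_cast hk)]
  have h := mul_sum_binOf_le (k := k) (M := 2 * edgeCount G) (v := labelVolume G a) (l' : ℕ)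
  refine le_trans (le_of_eq ?_) ((Nat.cast_le (α := ℝ)).2 h |>.trans (by push_cast; rfl))
  push_cast
  congr 1
  refine Finset.sum_bij (fun l _ => (l : ℕ)) ?_ (fun _ _ _ _ h => Fin.ext h) ?_ fun _ _ => rfl
  · intro l hl
    rw [Finset.mem_filter] at hl ⊢
    exact ⟨Finset.mem_range.2 hl.2.1, congrArg Fin.val hl.2.2⟩
  · intro j hj
    rw [Finset.mem_filter, Finset.mem_range] at hj
    exact ⟨⟨j, hj.1.trans l'.2⟩, Finset.mem_filter.2 ⟨Finset.mem_univ _, hj.1, Fin.ext hj.2⟩, rfl⟩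

end Bins

/-! ### The program -/

section Machine

/-- Perform a list of elementary operations and continue with a program. -/
def Program.ops (l : List Op) (p : Program) : Program := l.foldr (fun o q => .seq (.op o) q) p

theorem exec_ops (l : List Op) {p : Program} {s s' : Store} {t : ℕ}
    (h : Exec p (l.foldl (fun s o => o.run s) s) t s') :
    Exec (Program.ops l p) s (l.length + t) s' := by
  induction l generalizing s with
  | nil => simpa [Program.ops] using h
  | cons o l ih =>
    have := Exec.seq (Exec.op o s) (ih h)
    rwa [← add_assoc, add_comm 1] at this

/-- A loop whose counter starts at `N` and whose body costs at most `B` and decreases the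
counter by one. -/
theorem exec_whilePos (I : ℕ → Store → Prop) {i B N : ℕ} {p : Program}
    (hreg : ∀ j s, I j s → s.reg i = N - j)
    (hstep : ∀ j s, j < N → I j s → ∃ t s', t ≤ B ∧ Exec p s t s' ∧ I (j + 1) s')
    {s : Store} (hs : I 0 s) :
    ∃ t s', t ≤ (B + 1) * N + 1 ∧ Exec (.whilePos i p) s t s' ∧ I N s' := by
  suffices H : ∀ d j s, j + d = N → I j s →
      ∃ t s', t ≤ (B + 1) * d + 1 ∧ Exec (.whilePos i p) s t s' ∧ I N s' from
    H N 0 s (by omega) hs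
  intro d
  induction d with
  | zero =>
    intro j s hj hI
    obtain rfl : j = N := by omega
    exact ⟨1, s, by omega, .whilePos_zero (by simp [hreg j s hI]), hI⟩
  | succ d ih =>
    intro j s hj hI
    obtain ⟨t, s', ht, he, hI'⟩ := hstep j s (by omega) hI
    obtain ⟨t', s'', ht', he', hI''⟩ := ih (j + 1) s' (by omega) hI'
    refine ⟨t + t' + 1, s'', ?_, .whilePos_pos (by rw [hreg j s hI]; omega) he he', hI''⟩
    rw [mul_add]
    omega

/-- Add `1` to the volume of the label of the end of an edge at address `r₄`. -/
def countStep : Program :=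
  .ops [.load 6 4, .load 6 6, .add 6 6 2, .load 7 6, .add 7 7 3, .store 6 7, .add 4 4 3]
    (.op (.sub 5 5 3))

/-- Put label `r₄` into a bin, and write the name of the bin over its volume. The registers `6` and
`7` hold the volume and the name of the current bin. -/
def binStep (k : ℕ) : Program :=
  .ops (.const 8 0 :: List.replicate k (.add 8 8 6) ++ [.sub 8 8 10])
    (.seq (.ifPos 8 (.ops [.const 6 0] (.op (.add 7 4 11))) (.op (.const 8 0)))
      (.ops [.add 9 2 4, .load 8 9, .add 6 6 8, .store 9 7, .add 4 4 3] (.op (.sub 5 5 3))))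

/-- Replace the label at address `r₄` by the name of its bin. -/
def relabelStep : Program :=
  .ops [.load 6 4, .add 6 6 2, .load 6 6, .store 4 6, .add 4 4 3] (.op (.sub 5 5 3))

/-- The merging algorithm: count the volumes of the labels, put the labels into bins that are closed
as soon as `k` times their volume is larger than twice the number of edges, and relabel. The
volumes and the names of the bins are kept behind the input, from the address in register `2` on;
register `11` always holds `0`. -/
def mergeProgram (k : ℕ) : Program :=
  .ops [.add 2 0 1, .add 2 2 1, .const 3 1, .add 4 0 11, .add 5 1 1, .add 10 1 1]
    (.seq (.whilePos 5 countStep)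
      (.ops [.const 4 0, .add 5 0 11, .const 6 0, .const 7 0]
        (.seq (.whilePos 5 (binStep k))
          (.ops [.const 4 0, .add 5 0 11] (.whilePos 5 relabelStep)))))

/-- The number of `i < j` such that the end at position `i` in the list of edges has label `l`. -/
def labelCount (α β : ℕ → ℕ) (j l : ℕ) : ℕ :=
  ∑ i ∈ Finset.range j, if α (β i) = l then 1 else 0

theorem labelCount_succ (α β : ℕ → ℕ) (j l : ℕ) :
    labelCount α β (j + 1) l = labelCount α β j l + if α (β j) = l then 1 else 0 :=
  Finset.sum_range_succ _ _

/-- The loop of `countStep` has handled `j` ends of edges. -/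
structure CountInv (n m : ℕ) (α β : ℕ → ℕ) (j : ℕ) (s : Store) : Prop where
  r0 : s.reg 0 = n
  r2 : s.reg 2 = n + m + m
  r3 : s.reg 3 = 1
  r4 : s.reg 4 = n + j
  r5 : s.reg 5 = m + m - j
  r10 : s.reg 10 = m + m
  r11 : s.reg 11 = 0
  label : ∀ u < n, s.mem u = α u
  edge : ∀ i < m + m, s.mem (n + i) = β i
  vol : ∀ l < n, s.mem (n + m + m + l) = labelCount α β j l

/-- The loop of `binStep` has handled the labels less than `l`. -/
structure BinInv (n m k : ℕ) (α v : ℕ → ℕ) (l : ℕ) (s : Store) : Prop where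
  r0 : s.reg 0 = n
  r2 : s.reg 2 = n + m + m
  r3 : s.reg 3 = 1
  r4 : s.reg 4 = l
  r5 : s.reg 5 = n - l
  r6 : s.reg 6 = (binState k (m + m) v l).1
  r7 : s.reg 7 = (binState k (m + m) v l).2
  r10 : s.reg 10 = m + m
  r11 : s.reg 11 = 0
  label : ∀ u < n, s.mem u = α u
  bin : ∀ i < l, s.mem (n + m + m + i) = binOf k (m + m) v i
  vol : ∀ i < n, l ≤ i → s.mem (n + m + m + i) = v i

/-- The loop of `relabelStep` has handled the vertices less than `u`. -/
structure RelabelInv (n m : ℕ) (α g : ℕ → ℕ) (u : ℕ) (s : Store) : Prop where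
  r2 : s.reg 2 = n + m + m
  r3 : s.reg 3 = 1
  r4 : s.reg 4 = u
  r5 : s.reg 5 = n - u
  bin : ∀ i < n, s.mem (n + m + m + i) = g i
  done : ∀ i < u, s.mem i = g (α i)
  label : ∀ i < n, u ≤ i → s.mem i = α i

theorem countStep_spec {n m : ℕ} {α β : ℕ → ℕ} (hα : ∀ u < n, α u < n)
    (hβ : ∀ i < m + m, β i < n) {j : ℕ} {s : Store} (hj : j < m + m) (h : CountInv n m α β j s) :
    ∃ t s', t ≤ 8 ∧ Exec countStep s t s' ∧ CountInv n m α β (j + 1) s' := by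
  refine ⟨8, _, le_rfl, exec_ops _ (Exec.op _ _), ?_⟩
  have h1 := h.edge j hj
  have h2 := h.label _ (hβ j hj)
  have h3 := h.vol _ (hα _ (hβ j hj))
  have h3' : s.mem (α (β j) + (n + m + m)) = labelCount α β j (α (β j)) := by rw [add_comm, h3]
  have h4 := hα _ (hβ j hj)
  constructor <;>
    simp only [List.foldl, Op.run, Function.update_apply, h.r0, h.r2, h.r3, h.r4, h.r5, h.r10,
      h.r11, h1, h2, h3', reduceIte, Nat.reduceEqDiff,
      OfNat.zero_ne_ofNat]
  · omega
  · omega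
  · intro u hu
    rw [if_neg (by omega), h.label u hu]
  · intro i hi
    rw [if_neg (by omega), h.edge i hi]
  · intro l hl
    rw [labelCount_succ]
    by_cases hll : α (β j) = l
    · rw [if_pos (by omega), if_pos hll, hll]
    · rw [if_neg (by omega), if_neg hll, h.vol l hl, add_zero]

theorem foldl_replicate_add (k : ℕ) (s : Store) :
    (List.replicate k (Op.add 8 8 6)).foldl (fun s o => o.run s) s =
      { s with reg := Function.update s.reg 8 (s.reg 8 + k * s.reg 6) } := by
  induction k generalizing s with
  | zero => simp
  | succ k ih =>
    rw [List.replicate_succ, List.foldl_cons, ih]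
    simp only [Op.run, Function.update_apply, reduceIte, Nat.reduceEqDiff, Function.update_idem]
    congr 2
    ring

theorem binStep_spec {n m k : ℕ} {α v : ℕ → ℕ} {l : ℕ} {s : Store} (hl : l < n)
    (h : BinInv n m k α v l s) :
    ∃ t s', t ≤ k + 11 ∧ Exec (binStep k) s t s' ∧ BinInv n m k α v (l + 1) s' := by
  set M := m + m
  set w := (binState k M v l).1 with hw
  set cur := (binState k M v l).2 with hcur
  -- the test whether the current bin is closed
  obtain ⟨s₁, hs₁, hm₁, h8, hr₁⟩ : ∃ s₁ : Store,
      (Op.const 8 0 :: List.replicate k (Op.add 8 8 6) ++ [Op.sub 8 8 10]).foldl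
        (fun s o => o.run s) s = s₁ ∧
      s₁.mem = s.mem ∧ s₁.reg 8 = k * w - M ∧ ∀ i, i ≠ 8 → s₁.reg i = s.reg i := by
    refine ⟨_, rfl, ?_⟩
    rw [List.foldl_append, List.foldl_cons, List.foldl_cons, foldl_replicate_add]
    simp only [List.foldl, Op.run, Function.update_apply, reduceIte, Nat.reduceEqDiff, h.r6, h.r10,
      zero_add, true_and]
    refine ⟨rfl, fun i hi => ?_⟩
    simp only [if_neg hi]
  obtain ⟨t₂, s₂, ht₂, he₂, hm₂, h6, h7, hr₂⟩ : ∃ t₂ s₂, t₂ ≤ 3 ∧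
      Exec (.ifPos 8 (.ops [.const 6 0] (.op (.add 7 4 11))) (.op (.const 8 0))) s₁ t₂ s₂ ∧
      s₂.mem = s.mem ∧ s₂.reg 6 = (if M < k * w then 0 else w) ∧
      s₂.reg 7 = (if M < k * w then l else cur) ∧
      ∀ i, i ≠ 6 → i ≠ 7 → i ≠ 8 → s₂.reg i = s.reg i := by
    by_cases hlt : M < k * w
    · refine ⟨3, _, le_rfl, .ifPos_pos (by omega) (exec_ops _ (.op _ _)), ?_⟩
      simp only [List.foldl, Op.run, Function.update_apply, reduceIte, Nat.reduceEqDiff, if_pos hlt,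
        hm₁, hr₁ 4 (by norm_num), hr₁ 11 (by norm_num), h.r4, h.r11, add_zero, true_and]
      intro i h6 h7 h8
      simp only [if_neg h6, if_neg h7, hr₁ i h8]
    · refine ⟨2, _, by norm_num, .ifPos_zero (by omega) (.op _ _), ?_⟩
      simp only [Op.run, Function.update_apply, reduceIte, Nat.reduceEqDiff, if_neg hlt,
        hm₁, hr₁ 6 (by norm_num), hr₁ 7 (by norm_num), h.r6, h.r7, true_and]
      refine ⟨hw.symm, hcur.symm, fun i h6 h7 h8 => ?_⟩
      simp only [if_neg h8, hr₁ i h8]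
  have hv := h.vol l hl le_rfl
  have hstate : binState k M v (l + 1) =
      ((if M < k * w then 0 else w) + v l, if M < k * w then l else cur) := by
    rw [binState]
    split_ifs <;> simp [hw, hcur]
  refine ⟨_, _, ?_, exec_ops _ (.seq (hs₁ ▸ he₂) (exec_ops _ (.op _ _))), ?_⟩
  · simp only [List.length_append, List.length_cons, List.length_replicate, List.length_nil]
    omega
  have h0 := (hr₂ 0 (by norm_num) (by norm_num) (by norm_num)).trans h.r0
  have h2 := (hr₂ 2 (by norm_num) (by norm_num) (by norm_num)).trans h.r2
  have h3 := (hr₂ 3 (by norm_num) (by norm_num) (by norm_num)).trans h.r3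
  have h4 := (hr₂ 4 (by norm_num) (by norm_num) (by norm_num)).trans h.r4
  have h5 := (hr₂ 5 (by norm_num) (by norm_num) (by norm_num)).trans h.r5
  have h10 := (hr₂ 10 (by norm_num) (by norm_num) (by norm_num)).trans h.r10
  have h11 := (hr₂ 11 (by norm_num) (by norm_num) (by norm_num)).trans h.r11
  constructor <;>
    simp only [List.foldl, Op.run, Function.update_apply, h0, h2, h3, h4, h5, h6, h7, h10, h11, hm₂,
      hv, reduceIte, Nat.reduceEqDiff, OfNat.zero_ne_ofNat]
  · omega
  · rw [hstate]
  · rw [hstate]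
  · intro u hu
    rw [if_neg (by omega), h.label u hu]
  · intro i hi
    by_cases hil : i = l
    · rw [if_pos (by omega), hil, binOf, hstate]
    · rw [if_neg (by omega), h.bin i (by omega)]
  · intro i hi hli
    rw [if_neg (by omega), h.vol i hi (by omega)]

theorem relabelStep_spec {n m : ℕ} {α g : ℕ → ℕ} (hα : ∀ u < n, α u < n) {u : ℕ} {s : Store}
    (hu : u < n) (h : RelabelInv n m α g u s) :
    ∃ t s', t ≤ 6 ∧ Exec relabelStep s t s' ∧ RelabelInv n m α g (u + 1) s' := by
  refine ⟨6, _, le_rfl, exec_ops _ (Exec.op _ _), ?_⟩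
  have h1 := h.label u hu le_rfl
  have h2 : s.mem (α u + (n + m + m)) = g (α u) := by rw [add_comm, h.bin _ (hα u hu)]
  constructor <;>
    simp only [List.foldl, Op.run, Function.update_apply, h.r2, h.r3, h.r4, h.r5,
      h1, h2, reduceIte, Nat.reduceEqDiff]
  · omega
  · intro i hi
    rw [if_neg (by omega), h.bin i hi]
  · intro i hi
    by_cases hiu : i = u
    · rw [if_pos hiu, hiu]
    · rw [if_neg hiu, h.done i (by omega)]
  · intro i hi hui
    rw [if_neg (by omega), h.label i hi (by omega)]

/-- The merging algorithm halts after a linear number of operations, with the names of the bins as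
labels. -/
theorem mergeProgram_spec (k : ℕ) {n m : ℕ} {α β : ℕ → ℕ} (hα : ∀ u < n, α u < n)
    (hβ : ∀ i < m + m, β i < n) {s : Store} (h0 : s.reg 0 = n) (h1 : s.reg 1 = m)
    (hreg : ∀ i, 1 < i → s.reg i = 0) (hlabel : ∀ u < n, s.mem u = α u)
    (hedge : ∀ i < m + m, s.mem (n + i) = β i) (hmem : ∀ i, s.mem (n + m + m + i) = 0) :
    ∃ t s', t ≤ (k + 20) * (n + m + 1) ∧ Exec (mergeProgram k) s t s' ∧
      ∀ u < n, s'.mem u = binOf k (m + m) (labelCount α β (m + m)) (α u) := by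
  obtain ⟨t₁, s₁, ht₁, he₁, I₁⟩ := exec_whilePos (CountInv n m α β) (i := 5) (N := m + m)
    (fun _ _ h => h.r5) (fun _ _ hj h => countStep_spec hα hβ hj h)
    (s := [Op.add 2 0 1, .add 2 2 1, .const 3 1, .add 4 0 11, .add 5 1 1, .add 10 1 1].foldl
      (fun s o => o.run s) s) (by
      constructor <;>
        simp only [List.foldl, Op.run, Function.update_apply, h0, h1, hreg 11 (by norm_num),
          reduceIte, Nat.reduceEqDiff, OfNat.zero_ne_ofNat, OfNat.one_ne_ofNat, add_zero,
          Nat.sub_zero]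
      · exact hlabel
      · exact hedge
      · exact fun l _ => hmem l)
  obtain ⟨t₂, s₂, ht₂, he₂, I₂⟩ := exec_whilePos
    (BinInv n m k α (labelCount α β (m + m))) (i := 5) (N := n)
    (fun _ _ h => h.r5) (fun _ _ hl h => binStep_spec hl h)
    (s := [Op.const 4 0, .add 5 0 11, .const 6 0, .const 7 0].foldl (fun s o => o.run s) s₁) (by
      constructor <;>
        simp only [List.foldl, Op.run, Function.update_apply, I₁.r0, I₁.r2, I₁.r3, I₁.r10, I₁.r11,
          reduceIte, Nat.reduceEqDiff, OfNat.zero_ne_ofNat, add_zero, Nat.sub_zero, binState]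
      · exact I₁.label
      · exact fun i hi => absurd hi (Nat.not_lt_zero i)
      · exact fun i hi _ => I₁.vol i hi)
  obtain ⟨t₃, s₃, ht₃, he₃, I₃⟩ := exec_whilePos
    (RelabelInv n m α (binOf k (m + m) (labelCount α β (m + m)))) (i := 5) (N := n)
    (fun _ _ h => h.r5) (fun _ _ hu h => relabelStep_spec hα hu h)
    (s := [Op.const 4 0, .add 5 0 11].foldl (fun s o => o.run s) s₂) (by
      constructor <;>
        simp only [List.foldl, Op.run, Function.update_apply, I₂.r0, I₂.r2, I₂.r3, I₂.r11,
          reduceIte, Nat.reduceEqDiff, OfNat.zero_ne_ofNat, add_zero, Nat.sub_zero]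
      · exact I₂.bin
      · exact fun i hi => absurd hi (Nat.not_lt_zero i)
      · exact fun i hi _ => I₂.label i hi)
  refine ⟨_, s₃, ?_, exec_ops _ (.seq he₁ (exec_ops _ (.seq he₂ (exec_ops _ he₃)))), I₃.done⟩
  simp only [List.length_cons, List.length_nil]
  nlinarith

end Machine

/-! ### Reading the input -/

section Input

variable {n : ℕ}

/-- The ends of the edges in the list `L`. -/
def ends (L : List (Fin n × Fin n)) : List (Fin n) := L.flatMap fun p => [p.1, p.2]

theorem length_ends (L : List (Fin n × Fin n)) : (ends L).length = L.length + L.length := by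
  induction L with
  | nil => rfl
  | cons p L ih =>
    simp only [ends, List.flatMap_cons, List.length_append, List.length_cons, List.length_nil] at *
    omega

theorem sum_map_ends (L : List (Fin n × Fin n)) (f : Fin n → ℕ) :
    ((ends L).map f).sum = (L.map fun p => f p.1 + f p.2).sum := by
  induction L with
  | nil => rfl
  | cons p L ih =>
    simp only [ends, List.flatMap_cons, List.map_append, List.sum_append, List.map_cons,
      List.sum_cons, List.map_nil, List.sum_nil] at *
    omega

open scoped Classical in
theorem length_eq_edgeCount {H : SimpleGraph (Fin n)} {L : List (Fin n × Fin n)}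
    (hL : IsEdgeList H L) : L.length = edgeCount H := by
  have h1 : ((L.map fun p => s(p.1, p.2)).toFinset : Set (Sym2 (Fin n))) = H.edgeSet := by
    ext e
    rw [Finset.mem_coe, List.mem_toFinset, hL.2]
  rw [edgeCount, ← h1, Set.ncard_coe_finset, List.toFinset_card_of_nodup hL.1, List.length_map]

open scoped Classical in
/-- In the list of the ends of the edges, every vertex occurs as often as its degree says. -/
theorem sum_map_ends_eq {H : SimpleGraph (Fin n)} {L : List (Fin n × Fin n)}
    (hL : IsEdgeList H L) (f : Fin n → ℕ) :
    ((ends L).map f).sum = ∑ u, H.degree u * f u := by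
  have h1 : (L.map fun p => s(p.1, p.2)).toFinset = H.edgeFinset := by
    ext e
    rw [List.mem_toFinset, hL.2, SimpleGraph.mem_edgeFinset]
  have h2 : (L.map fun p => f p.1 + f p.2) =
      (L.map fun p => s(p.1, p.2)).map fun e => ∑ u, if u ∈ e then f u else 0 := by
    rw [List.map_map]
    refine List.map_congr_left fun p hp => ?_
    have hadj : H.Adj p.1 p.2 := by
      rw [← SimpleGraph.mem_edgeSet, ← hL.2]
      exact List.mem_map.2 ⟨p, hp, rfl⟩
    rw [Function.comp, ← Finset.sum_filter, ← Finset.sum_pair hadj.ne]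
    congr 1
    ext u
    simp
  rw [sum_map_ends, h2, ← List.sum_toFinset _ hL.1, h1, Finset.sum_comm]
  refine Finset.sum_congr rfl fun u _ => ?_
  rw [← Finset.sum_filter, Finset.sum_const, smul_eq_mul, ← SimpleGraph.incidenceFinset_eq_filter,
    SimpleGraph.card_incidenceFinset_eq_degree]

theorem inputStore_mem_label (L : List (Fin n × Fin n)) (a : Fin n → Fin n) (u : Fin n) :
    (inputStore L a).mem u = a u := by
  simp [inputStore, List.getElem?_append]

theorem inputStore_mem_add (L : List (Fin n × Fin n)) (a : Fin n → Fin n) (i : ℕ) :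
    (inputStore L a).mem (n + i) = ((ends L).map Fin.val).getD i 0 := by
  have : (L.flatMap fun p => [(p.1 : ℕ), (p.2 : ℕ)]) = (ends L).map Fin.val := by
    simp [ends, List.map_flatMap]
  simp only [inputStore, this, List.getD_eq_getElem?_getD]
  rw [List.getElem?_append_right (by simp)]
  simp

/-- Extend labels to natural numbers. -/
def natLabel (a : Fin n → Fin n) (u : ℕ) : ℕ := if h : u < n then a ⟨u, h⟩ else 0

theorem natLabel_val (a : Fin n → Fin n) (u : Fin n) : natLabel a u = a u := dif_pos u.2

theorem sum_range_getD (P : List (Fin n)) (f : ℕ → ℕ) :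
    ∑ i ∈ Finset.range P.length, f ((P.map Fin.val).getD i 0) = (P.map fun u : Fin n => f u).sum := by
  induction P with
  | nil => rfl
  | cons x P ih =>
    rw [List.length_cons, Finset.sum_range_succ', List.map_cons, List.map_cons, List.sum_cons,
      ← ih]
    simp [add_comm]

theorem labelCount_eq_labelVolume {H : SimpleGraph (Fin n)} {L : List (Fin n × Fin n)}
    (hL : IsEdgeList H L) (a : Fin n → Fin n) :
    labelCount (natLabel a) (fun i => ((ends L).map Fin.val).getD i 0) (L.length + L.length) =
      labelVolume H a := by
  classical
  funext l
  rw [labelCount, ← length_ends,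
    sum_range_getD (ends L) fun x => if natLabel a x = l then 1 else 0, sum_map_ends_eq hL,
    labelVolume, Finset.sum_filter]
  refine Finset.sum_congr rfl fun u _ => ?_
  rw [natLabel_val]
  split_ifs <;> simp

/-- The merging algorithm outputs the partition into the unions of the parts in each bin. -/
theorem findsWithin_mergeProgram (k : ℕ) (H : SimpleGraph (Fin n))
    (A : Finpartition (Finset.univ : Finset (Fin n)))
    {good : Finpartition (Finset.univ : Finset (Fin n)) → Prop}
    (hgood : ∀ (a : Fin n → Fin n) (A' : Finpartition (Finset.univ : Finset (Fin n))),
      IsLabelling a A → IsLabelling (binLabel k (2 * edgeCount H) (labelVolume H a) ∘ a) A' →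
      good A') :
    FindsWithin (mergeProgram k) ((k + 20) * (n + edgeCount H + 1)) H A good := by
  intro L a hL ha
  have hlen := length_eq_edgeCount hL
  set f := binLabel k (2 * edgeCount H) (labelVolume H a) ∘ a with hf
  have hA' := isLabelling_labelPartition f
  obtain ⟨t, s, ht, he, hs⟩ := mergeProgram_spec k (n := n) (m := L.length) (α := natLabel a)
    (β := fun i => ((ends L).map Fin.val).getD i 0) (s := inputStore L a)
    (fun u hu => by rw [natLabel, dif_pos hu]; exact Fin.is_lt _)
    (fun i hi => by
      rw [← length_ends] at hi
      simp only [List.getD_eq_getElem?_getD, List.getElem?_map, List.getElem?_eq_getElem hi]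
      exact Fin.is_lt _)
    (by simp [inputStore]) (by simp [inputStore])
    (fun i hi => by simp only [inputStore]; rw [if_neg (by omega), if_neg (by omega)])
    (fun u hu => by rw [inputStore_mem_label L a ⟨u, hu⟩, natLabel, dif_pos hu])
    (fun i _ => inputStore_mem_add L a i)
    (fun i => by
      rw [add_assoc, add_assoc, inputStore_mem_add, List.getD_eq_default]
      rw [List.length_map, length_ends]
      omega)
  refine ⟨t, s, labelPartition f, hlen ▸ ht, he, ⟨f, hA', fun u => ?_⟩, hgood a _ ha hA'⟩
  rw [hs u u.2, labelCount_eq_labelVolume hL, natLabel_val, hlen, ← two_mul]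
  rfl

end Input

/-! ### From bounded partitions to all partitions -/

section Transfer

variable {n k : ℕ} {G H : SimpleGraph (Fin n)} {η : ℝ}

theorem modularity_le_add (hk : 0 < k)
    (h : ∀ A : Finpartition (Finset.univ : Finset (Fin n)), A.parts.card ≤ k →
      |modScore H A - modScore G A| ≤ η) :
    modularity G ≤ modularity H + η + 2 * (1 / k) := by
  obtain ⟨A, hA⟩ := exists_modScore_eq_modularity G
  obtain ⟨a, ha⟩ := exists_isLabelling A
  have hA' := isLabelling_labelPartition (binLabel k (2 * edgeCount G) (labelVolume G a) ∘ a)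
  have h1 := modScore_le_binLabel G hk ha hA'
  have h2 := abs_le.1 (h _ (card_parts_binLabel_le G hk hA'))
  have h3 := modScore_le_modularity H (labelPartition
    (binLabel k (2 * edgeCount G) (labelVolume G a) ∘ a))
  linarith

/-- Merging parts according to the volumes in `H` yields a partition that is good for `G`. -/
theorem deficit_binLabel_le (hk : 0 < k)
    (h : ∀ A : Finpartition (Finset.univ : Finset (Fin n)), A.parts.card ≤ k →
      |modScore H A - modScore G A| ≤ η)
    {a : Fin n → Fin n} {A A' : Finpartition (Finset.univ : Finset (Fin n))}
    (hA : IsLabelling a A)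
    (hA' : IsLabelling (binLabel k (2 * edgeCount H) (labelVolume H a) ∘ a) A') :
    deficit G A' ≤ deficit H A + 2 * η + 4 * (1 / k) := by
  have h1 := modularity_le_add hk h
  have h2 := modScore_le_binLabel H hk hA hA'
  have h3 := abs_le.1 (h _ (card_parts_binLabel_le H hk hA'))
  unfold deficit
  linarith

end Transfer

/-! ### The sampled graph -/

section Sample

open scoped ENNReal

variable {n : ℕ} {G : SimpleGraph (Fin n)}

open scoped Classical in
/-- In the definition of the search, the law of the finset of found edges is first pushed forward to
a law on sets. -/
theorem edgeLimitedSearch_eq_map (G : SimpleGraph (Fin n)) (b : ℝ) :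
    edgeLimitedSearch G b = (searchLoop G b (⊤ : SimpleGraph (Fin n)).edgeFinset ∅).map
      fun F : Finset (Sym2 (Fin n)) => SimpleGraph.fromEdgeSet (F : Set (Sym2 (Fin n))) :=
  PMF.map_comp (fun F : Finset (Sym2 (Fin n)) => (F : Set (Sym2 (Fin n)))) _
    SimpleGraph.fromEdgeSet

theorem edgeSet_fromEdgeSet_of_subset {F : Finset (Sym2 (Fin n))} (hF : ∀ e ∈ F, e ∈ G.edgeSet) :
    (SimpleGraph.fromEdgeSet (F : Set (Sym2 (Fin n)))).edgeSet = F := by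
  rw [SimpleGraph.edgeSet_fromEdgeSet, sdiff_eq_left, Set.disjoint_left]
  exact fun e he hd => G.not_isDiag_of_mem_edgeSet (hF e he) hd

theorem edgeCount_fromEdgeSet {F : Finset (Sym2 (Fin n))} (hF : ∀ e ∈ F, e ∈ G.edgeSet) :
    edgeCount (SimpleGraph.fromEdgeSet (F : Set (Sym2 (Fin n)))) = F.card := by
  rw [edgeCount, edgeSet_fromEdgeSet_of_subset hF, Set.ncard_coe_finset]

theorem innerEdges_fromEdgeSet {F : Finset (Sym2 (Fin n))} (hF : ∀ e ∈ F, e ∈ G.edgeSet)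
    (S : Finset (Fin n)) :
    innerEdges (SimpleGraph.fromEdgeSet (F : Set (Sym2 (Fin n)))) S = F ∩ innerEdges G S := by
  ext e
  rw [Finset.mem_inter, mem_innerEdges, mem_innerEdges, edgeSet_fromEdgeSet_of_subset hF,
    Finset.mem_coe]
  exact ⟨fun h => ⟨h.1, hF e h.1, h.2⟩, fun h => ⟨h.1, h.2.2⟩⟩

theorem abs_innerDensity_sub_le {F : Finset (Sym2 (Fin n))} (hF : ∀ e ∈ F, e ∈ G.edgeSet) {N : ℕ}
    (hN : 0 < N) (hFN : F.card = N) {η : ℝ} {S : Finset (Fin n)}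
    (h : |((F ∩ innerEdges G S).card : ℝ) - N * (innerEdges G S).card / edgeCount G| ≤ η * N) :
    |innerDensity (SimpleGraph.fromEdgeSet (F : Set (Sym2 (Fin n)))) S - innerDensity G S| ≤ η := by
  have hN' : (0 : ℝ) < N := by exact_mod_cast hN
  rw [innerDensity, innerDensity, innerEdges_fromEdgeSet hF, edgeCount_fromEdgeSet hF, hFN]
  have : ((F ∩ innerEdges G S).card : ℝ) / N - (innerEdges G S).card / edgeCount G =
      (((F ∩ innerEdges G S).card : ℝ) - N * (innerEdges G S).card / edgeCount G) / N := by
    field_simp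
  rw [this, abs_div, abs_of_pos hN']
  exact div_le_of_le_mul₀ hN'.le (le_trans (abs_nonneg _) h |> fun h0 =>
    nonneg_of_mul_nonneg_left h0 hN') h

/-- The union bound over the `2 ^ n` vertex sets. -/
theorem searchLoop_bad_le {N : ℕ} (hN : N ≤ edgeCount G) {η : ℝ} (hη0 : 0 < η) (hη1 : η ≤ 1) :
    (searchLoop G N (⊤ : SimpleGraph (Fin n)).edgeFinset ∅).toOuterMeasure
        {F | ∃ S, η * N ≤
          |((F ∩ innerEdges G S).card : ℝ) - N * (innerEdges G S).card / edgeCount G|} ≤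
      ENNReal.ofReal (2 ^ n * (2 * Real.exp (-(η ^ 2 * N / 4)))) := by
  have h : {F : Finset (Sym2 (Fin n)) | ∃ S, η * N ≤
      |((F ∩ innerEdges G S).card : ℝ) - N * (innerEdges G S).card / edgeCount G|} =
      ⋃ S ∈ (Finset.univ : Finset (Finset (Fin n))), {F | η * N ≤
        |((F ∩ innerEdges G S).card : ℝ) - N * (innerEdges G S).card / edgeCount G|} := by
    ext F; simp
  rw [h]
  refine (MeasureTheory.measure_biUnion_finset_le _ _).trans
    ((Finset.sum_le_card_nsmul _ _ _ fun S _ => searchLoop_tail_le G hN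
      (fun e he => (mem_innerEdges.1 he).1) hη0 hη1).trans (le_of_eq ?_))
  rw [Finset.card_univ, Fintype.card_finset, Fintype.card_fin, nsmul_eq_mul,
    ENNReal.ofReal_mul (p := 2 ^ n) (by positivity), ENNReal.ofReal_pow (by norm_num)]
  simp

theorem ofReal_one_sub_le_of_support {α : Type*} (p : PMF α) {good bad : Set α} {ε : ℝ}
    (hε : 0 ≤ ε) (h : p.support ⊆ good ∪ bad) (hbad : p.toOuterMeasure bad ≤ ENNReal.ofReal ε) :
    ENNReal.ofReal (1 - ε) ≤ p.toOuterMeasure good := by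
  rw [ENNReal.ofReal_sub 1 hε, ENNReal.ofReal_one, tsub_le_iff_right,
    ← (p.toOuterMeasure_apply_eq_one_iff (good ∪ bad)).2 h]
  exact (MeasureTheory.measure_union_le _ _).trans (add_le_add le_rfl hbad)

open scoped Classical in
/-- With high probability, the score of every partition with at most `k` parts is almost the same
in `G` and in the sampled graph. -/
theorem edgeLimitedSearch_close (G : SimpleGraph (Fin n)) {c k : ℕ} (hc : 0 < c) {η ε : ℝ}
    (hη0 : 0 < η) (hη1 : η ≤ 1) (hε0 : 0 ≤ ε)
    (hε : n ≠ 0 → 2 ^ n * (2 * Real.exp (-(η ^ 2 * (c * n : ℕ) / 4))) ≤ ε) :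
    ENNReal.ofReal (1 - ε) ≤ (edgeLimitedSearch G (c * n)).toOuterMeasure
      {H | ∀ A : Finpartition (Finset.univ : Finset (Fin n)), A.parts.card ≤ k →
        |modScore H A - modScore G A| ≤ k * (3 * η)} := by
  set N := c * n with hN
  have hb : (c : ℝ) * n = (N : ℕ) := by rw [hN]; push_cast; rfl
  rw [edgeLimitedSearch_eq_map, PMF.toOuterMeasure_map_apply, hb]
  set p := searchLoop G N (⊤ : SimpleGraph (Fin n)).edgeFinset ∅ with hp
  have hsupp : ∀ F ∈ p.support, (∀ e ∈ F, e ∈ G.edgeSet) ∧ F.card ≤ N ∧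
      (F.card = N ∨ G.edgeFinset ⊆ F) := fun F hF => by
    obtain ⟨-, h1, h2, h3⟩ := searchLoop_support G N _ ∅ F (by simp) hF
    refine ⟨fun e he => ?_, h2, h3.imp id fun h e he => ?_⟩
    · exact (h1 e he).elim (fun h => absurd h (Finset.notMem_empty e)) And.right
    · rw [SimpleGraph.mem_edgeFinset] at he
      exact h e (SimpleGraph.mem_edgeFinset.2 (SimpleGraph.edgeSet_mono le_top he)) he
  by_cases hm : edgeCount G ≤ N
  · -- all edges are found
    refine ofReal_one_sub_le_of_support p (bad := ∅) hε0 (fun F hF => Or.inl ?_) (by simp)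
    obtain ⟨h1, h2, h3⟩ := hsupp F hF
    have hsub : F ⊆ G.edgeFinset := fun e he => SimpleGraph.mem_edgeFinset.2 (h1 e he)
    have hFG : F = G.edgeFinset := by
      rcases h3 with h3 | h3
      · exact Finset.eq_of_subset_of_card_le hsub (by rw [← edgeCount_eq_card]; omega)
      · exact hsub.antisymm h3
    have hH : SimpleGraph.fromEdgeSet (F : Set (Sym2 (Fin n))) = G := by
      rw [hFG, SimpleGraph.coe_edgeFinset, SimpleGraph.fromEdgeSet_edgeSet]
    rw [Set.mem_preimage, hH]
    intro A _
    rw [sub_self, abs_zero]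
    positivity
  · push Not at hm
    have hn : n ≠ 0 := by
      rintro rfl
      have := sum_degree_eq G
      rw [Finset.univ_eq_empty, Finset.sum_empty] at this
      have h0 : (edgeCount G : ℝ) = 0 := by linarith
      have h0' : edgeCount G = 0 := by exact_mod_cast h0
      omega
    have hN0 : 0 < N := Nat.mul_pos hc (Nat.pos_of_ne_zero hn)
    set bad : Set (Finset (Sym2 (Fin n))) := {F | ∃ S, η * N ≤
      |((F ∩ innerEdges G S).card : ℝ) - N * (innerEdges G S).card / edgeCount G|} with hbad
    have hPbad : p.toOuterMeasure bad ≤ ENNReal.ofReal ε :=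
      (searchLoop_bad_le hm.le hη0 hη1).trans (ENNReal.ofReal_le_ofReal (hε hn))
    refine ofReal_one_sub_le_of_support p hε0 (fun F hF => ?_) hPbad
    refine or_iff_not_imp_right.2 fun hFb => ?_
    obtain ⟨h1, h2, h3⟩ := hsupp F hF
    have hFN : F.card = N := by
      rcases h3 with h3 | h3
      · exact h3
      · have := Finset.card_le_card h3
        rw [← edgeCount_eq_card] at this
        omega
    simp only [hbad, Set.mem_ofPred_eq, not_exists, not_le] at hFb
    intro A hA
    have hH : edgeCount (SimpleGraph.fromEdgeSet (F : Set (Sym2 (Fin n)))) ≠ 0 := by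
      rw [edgeCount_fromEdgeSet h1]
      omega
    refine (abs_modScore_sub_le (by omega) hH
      (fun S => abs_innerDensity_sub_le h1 hN0 hFN (hFb S).le) A).trans ?_
    have : (A.parts.card : ℝ) ≤ k := by exact_mod_cast hA
    gcongr

end Sample

end GraphModularity

theorem corollary2 (ε : ℝ) (hε : 0 < ε) :
    ∃ (c : ℝ) (p : GraphModularity.Program) (K : ℕ), 0 < c ∧
      -- on every input, the algorithm uses a linear number of operations
      (∀ (n : ℕ) (H : SimpleGraph (Fin n)) (A : Finpartition (Finset.univ : Finset (Fin n))),
        GraphModularity.FindsWithin p (K * (n + GraphModularity.edgeCount H + 1)) H A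
          (fun _ => True)) ∧
      -- the output graph `H` of the search has the properties (a) and (b) with high probability
      ∀ (n : ℕ) (G : SimpleGraph (Fin n)),
        ENNReal.ofReal (1 - ε) ≤
          (GraphModularity.edgeLimitedSearch G (c * n)).toOuterMeasure
            {H : SimpleGraph (Fin n) |
              |GraphModularity.modularity H - GraphModularity.modularity G| < ε ∧
              ∀ A : Finpartition (Finset.univ : Finset (Fin n)),
                GraphModularity.FindsWithin p (K * (n + GraphModularity.edgeCount H + 1)) H A
                  (fun A' => GraphModularity.deficit G A' ≤ GraphModularity.deficit H A + ε)} := by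
  open GraphModularity in
  obtain ⟨k, hk⟩ := exists_nat_gt (8 / ε)
  have hk0' : (0 : ℝ) < k := lt_trans (by positivity) hk
  have hk0 : 0 < k := by exact_mod_cast hk0'
  have hkε : 4 * (1 / (k : ℝ)) ≤ ε / 2 := by
    rw [div_lt_iff₀ hε] at hk
    rw [mul_one_div, div_le_iff₀ hk0']
    linarith
  -- the precision of the densities that gives precision `ε / 4` for the scores
  set η : ℝ := min 1 (ε / (12 * k)) with hη
  have hη0 : 0 < η := lt_min one_pos (by positivity)
  have hηk : k * (3 * η) ≤ ε / 4 := by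
    have h1 : η ≤ ε / (12 * k) := min_le_right _ _
    rw [le_div_iff₀ (by positivity)] at h1
    linarith
  obtain ⟨c, hc⟩ := exists_pow_lt_of_lt_one (x := min (ε / 4) (1 / 2))
    (y := Real.exp (-(η ^ 2 / 4))) (lt_min (by positivity) (by norm_num))
    (Real.exp_lt_one_iff.2 (by rw [neg_lt_zero]; positivity))
  have hc0 : 0 < c := by
    rcases Nat.eq_zero_or_pos c with rfl | h
    · rw [pow_zero] at hc
      have := hc.trans_le (min_le_right _ _)
      norm_num at this
    · exact h
  refine ⟨c, mergeProgram k, k + 20, by exact_mod_cast hc0, fun n H A =>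
    findsWithin_mergeProgram k H A fun _ _ _ _ => trivial, fun n G => ?_⟩
  refine (edgeLimitedSearch_close G (k := k) hc0 hη0 (min_le_left _ _) hε.le fun hn => ?_).trans
    (MeasureTheory.measure_mono fun H hH => ⟨?_, fun A => ?_⟩)
  · have h1 : Real.exp (-(η ^ 2 * (c * n : ℕ) / 4)) = (Real.exp (-(η ^ 2 / 4)) ^ c) ^ n := by
      rw [← pow_mul, ← Real.exp_nat_mul]
      congr 1
      ring
    set r := Real.exp (-(η ^ 2 / 4)) ^ c with hr
    have hr0 : 0 ≤ r := by positivity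
    have hr1 := hc.le.trans (min_le_left _ _)
    have hr2 := hc.le.trans (min_le_right _ _)
    have h2 : (2 * r) ^ n ≤ 2 * r := pow_le_of_le_one (by positivity) (by linarith) hn
    rw [h1]
    rw [mul_pow] at h2
    linarith
  · have hH' : ∀ A : Finpartition (Finset.univ : Finset (Fin n)), A.parts.card ≤ k →
        |modScore G A - modScore H A| ≤ k * (3 * η) := fun A hA => by
      rw [abs_sub_comm]; exact hH A hA
    have h1 := modularity_le_add hk0 hH
    have h2 := modularity_le_add hk0 hH'
    rw [abs_lt]
    constructor <;> linarith
  · refine findsWithin_mergeProgram k H A fun a A' hA hA' => ?_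
    have := deficit_binLabel_le hk0 hH hA hA'
    linarith
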